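/- **Setting.** Let $S$ and $A$ be (standard) Borel spaces, let $K\subseteq S\times A$ be a Borel set containing the graph of a measurable map $S\to A$, and put $A(x)=\{a:(x,a)\in K\}$. Let $q(dy\mid x,a)$, $(x,a)\in K$, be a finite signed kernel on $S$ with $q(\Gamma\mid x,a)\ge 0$ whenever $x\notin\Gamma$, with $q(S\mid x,a)=0$ and $\bar q_x:=\sup_{a\in A(x)}q_x(a)<\infty$ for every $x\in S$, where $q_x(a):=-q(\{x\}\mid x,a)$; put $q(\cdot\mid x,a)=0$ for $(x,a)\notin K$. Let $\alpha>0$. Let $\Omega$ be the set of sequences $\omega=(x_0,\theta_1,x_1,\theta_2,x_2,\dots)$ with $x_0\in S$ such that either all $\theta_n\in(0,\infty)$ and all $x_n\in S$, or this is so up to some index and all later pairs are $(\theta_n,x_n)=(\infty,x_\infty)$, with an isolated point $x_\infty\notin S$. Put $T_0=0$, $T_m=\theta_1+\dots+\theta_m$, $T_\infty=\lim_m T_m$; let $\xi_t=x_m$ for $T_m\le t<T_{m+1}$ and $\xi_t=x_\infty$ for $t\ge T_\infty$; let $\xi_{0-}=x_0$, $\xi_{t-}=x_m$ for $T_m<t\le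 T_{m+1}$ and $\xi_{t-}=x_\infty$ for $t\ge T_\infty$. Let $\mathcal F_t=\sigma(\{T_m\le s,\,x_m\in\Gamma\}:\Gamma\in\mathcal B(S),\,s\le t,\,m\ge 0)$. A *randomized history-dependent policy* $\pi$ is a transition probability $\pi(da\mid\omega,t)$ from $\Omega\times[0,\infty)$, equipped with the predictable $\sigma$-algebra of $(\mathcal F_t)$, to $A\cup\{a_\infty\}$ ($a_\infty\notin A$ an isolated point), concentrated on $A(\xi_{t-}(\omega))$, where $A(x_\infty):=\{a_\infty\}$. For a history $h_k=(x_0,\theta_1,\dots,\theta_k,x_k)$ with $\theta_k<\infty$ let $$\Lambda^k(\Gamma\mid h_k,s)=\int_A\pi(da\mid h_k,T_k+s)\,q(\Gamma\setminus\{x_k\}\mid x_k,a),$$ where $\pi(\cdot\mid h_k,T_k+s)$ is the value of $\pi$ at time $T_k+s$ on paths with history $h_k$ and $T_{k+1}\ge T_k+s$. For $x\in S$, $P_x^\pi$ is the probability measure on $\Omega$ under which $x_0=x$ and, given $h_k$ with $\theta_k<\infty$, the pair $(\theta_{k+1},x_{k+1})$ has law $\Lambda^k(dy\mid h_k,s)\,e^{-\int_0^s\Lambda^k(S\mid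 h_k,v)dv}\,ds$ on $(0,\infty)\times S$ and equals $(\infty,x_\infty)$ with probability $e^{-\int_0^\infty\Lambda^k(S\mid h_k,v)dv}$. $E_x^\pi$ is the expectation under $P_x^\pi$. Functions on $S$ are extended by $0$ to $x_\infty$. **Theorem.** Suppose the following conditions hold. 1. There are a measurable $w:S\to[1,\infty)$ and constants $\rho,b\ge 0$ such that: (a) there are measurable sets $S_0\subseteq S_1\subseteq\cdots$ with $\bigcup_l S_l=S$ and $\lim_{l\to\infty}\inf_{x\in S\setminus S_l}w(x)=\infty$ (where $\inf\emptyset=\infty$); (b) $\int_S q(dy\mid x,a)w(y)\le\rho w(x)+b$ for all $x\in S$, $a\in A(x)$; (c) $\sup_{x\in S_l}\bar q_x<\infty$ for every $l$. 2. There are a measurable $w':S\to[1,\infty)$ and constants $L',\rho',b'\ge 0$ such that: (a) $(\bar q_x+1)w'(x)\le L'w(x)$ for all $x\in S$; (b) $\int_S q(dy\mid x,a)w'(y)\le\rho' w'(x)+b'$ for all $x\in S$, $a\in A(x)$. Then for every measurable $u:S\to\mathbb R$ with $\sup_{x\in S}|u(x)|/w'(x)<\infty$, every randomized history-dependent policy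 $\pi$, every $x\in S$ and every $t\ge 0$, one has $P_x^\pi(\xi_t\in S)=1$, all integrals below are well defined and finite, and $$E_x^\pi[u(\xi_t)]-u(x)=E_x^\pi\left[\int_0^t\int_A\pi(da\mid\omega,v)\int_S q(dy\mid\xi_v,a)\,u(y)\,dv\right],$$ $$E_x^\pi[u(\xi_t)]\,e^{-\alpha t}-u(x)=E_x^\pi\left[\int_0^t e^{-\alpha v}\left\{-\alpha u(\xi_v)+\int_A\pi(da\mid\omega,v)\int_S q(dy\mid\xi_v,a)\,u(y)\right\}dv\right].$$ -/

import Mathlib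

open MeasureTheory ProbabilityTheory Set Filter Topology
open scoped NNReal ENNReal

noncomputable section

namespace CTMDP

/-! ### Two facts used to see that the law of the process is well defined -/

/-- `e^{-r}` for `r ∈ [0, ∞]`, with `e^{-∞} = 0`. -/
def expNeg (r : ℝ≥0∞) : ℝ≥0∞ := EReal.exp (-(r : EReal))

theorem measurable_expNeg : Measurable expNeg :=
  EReal.measurable_exp.comp (measurable_coe_ennreal_ereal.neg)

theorem continuous_expNeg : Continuous expNeg :=
  ENNReal.continuous_exp.comp (continuous_coe_ennreal_ereal.neg)

theorem expNeg_ofReal {r : ℝ} (hr : 0 ≤ r) :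
    expNeg (ENNReal.ofReal r) = ENNReal.ofReal (Real.exp (-r)) := by
  rw [expNeg, EReal.coe_ennreal_ofReal, max_eq_left hr, ← EReal.coe_neg, EReal.exp_coe]

/-- A kernel all of whose measures are finite is s-finite. -/
theorem isSFiniteKernel_of_finite {X Y : Type*} [MeasurableSpace X] [MeasurableSpace Y]
    (κ : Kernel X Y) (h : ∀ x, κ x univ < ∞) : IsSFiniteKernel κ := by
  classical
  let s : ℕ → Set X := fun n => {x | ⌊(κ x univ).toReal⌋₊ = n}
  have hs : ∀ n, MeasurableSet (s n) := fun n =>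
    (Nat.measurable_floor.comp (κ.measurable_coe MeasurableSet.univ).ennreal_toReal)
      (measurableSet_singleton n)
  refine ⟨⟨fun n => Kernel.piecewise (hs n) κ 0, fun n => ⟨⟨(n + 1 : ℕ), by simp, ?_⟩⟩, ?_⟩⟩
  · intro x
    rw [Kernel.piecewise_apply]
    split_ifs with hx
    · have h1 : (κ x univ).toReal < ⌊(κ x univ).toReal⌋₊ + 1 := Nat.lt_floor_add_one _
      have hx' : ⌊(κ x univ).toReal⌋₊ = n := hx
      rw [hx'] at h1
      rw [← ENNReal.ofReal_toReal (h x).ne, ← ENNReal.ofReal_natCast]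
      exact ENNReal.ofReal_le_ofReal (by push_cast; exact h1.le)
    · simp
  · ext x t ht
    rw [Kernel.sum_apply' _ _ ht, tsum_eq_single ⌊(κ x univ).toReal⌋₊]
    · rw [Kernel.piecewise_apply, if_pos (show x ∈ s _ from rfl)]
    · intro n hn
      rw [Kernel.piecewise_apply, if_neg (fun hx => hn hx.symm)]
      simp

/-- Total mass one of the sojourn-time law with bounded hazard rate `g`. -/
theorem lintegral_hazard {g : ℝ → ℝ≥0∞} (hg : Measurable g) {C : ℝ≥0} (hC : ∀ v, g v ≤ C) :
    (∫⁻ u in Ioi (0 : ℝ), expNeg (∫⁻ v in Ioc 0 u, g v) * g u)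
      + expNeg (∫⁻ v in Ioi (0 : ℝ), g v) = 1 := by
  set f : ℝ → ℝ := fun v => (g v).toReal with hf
  have hgf : ∀ v, g v = ENNReal.ofReal (f v) := fun v =>
    (ENNReal.ofReal_toReal (ne_top_of_le_ne_top ENNReal.coe_ne_top (hC v))).symm
  have hfm : Measurable f := hg.ennreal_toReal
  have hf0 : ∀ v, 0 ≤ f v := fun v => ENNReal.toReal_nonneg
  have hfC : ∀ v, f v ≤ C := fun v => ENNReal.toReal_le_coe_of_le_coe (hC v)
  have hfl : LocallyIntegrable f volume :=
    (locallyIntegrable_const (C : ℝ)).mono hfm.aestronglyMeasurable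
      (Eventually.of_forall fun v => by
        rw [Real.norm_of_nonneg (hf0 v)]; exact (hfC v).trans (le_abs_self _))
  have hfi : ∀ a b, IntervalIntegrable f volume a b := fun a b =>
    intervalIntegrable_iff.mpr <|
      (hfl.integrableOn_isCompact isCompact_uIcc).mono_set uIoc_subset_uIcc
  set F : ℝ → ℝ := fun u => ∫ v in (0 : ℝ)..u, f v with hF
  have hFcont : Continuous F := intervalIntegral.continuous_primitive hfi 0
  have hF0 : ∀ u, 0 ≤ u → 0 ≤ F u := fun u hu =>
    intervalIntegral.integral_nonneg hu fun v _ => hf0 v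
  have hG : ∀ u, 0 ≤ u → ∫⁻ v in Ioc 0 u, g v = ENNReal.ofReal (F u) := by
    intro u hu
    rw [hF]
    simp only
    rw [intervalIntegral.integral_of_le hu, ofReal_integral_eq_lintegral_ofReal
      ((hfi 0 u).1) (Eventually.of_forall hf0)]
    simp_rw [hgf]
  have hFac : ∀ T, AbsolutelyContinuousOnInterval F 0 T := fun T =>
    (hfi 0 T).absolutelyContinuousOnInterval_intervalIntegral (by simp)
  have hLip : LipschitzOnWith 1 (fun r : ℝ => Real.exp (-r)) (Ici 0) := by
    refine Convex.lipschitzOnWith_of_nnnorm_deriv_le (s := Ici (0 : ℝ))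
      (fun x _ => by fun_prop) ?_ (convex_Ici 0)
    intro x hx
    have : deriv (fun r : ℝ => Real.exp (-r)) x = -Real.exp (-x) := by
      have := ((hasDerivAt_neg x).exp).deriv
      simpa using this
    rw [this, ← NNReal.coe_le_coe, coe_nnnorm, norm_neg, Real.norm_of_nonneg (Real.exp_nonneg _)]
    simpa using hx
  have hFlip : LipschitzWith C F := by
    refine LipschitzWith.of_dist_le_mul fun a b => ?_
    rw [hF, Real.dist_eq, Real.dist_eq]
    simp only
    rw [intervalIntegral.integral_interval_sub_left (hfi _ _) (hfi _ _)]
    have := intervalIntegral.norm_integral_le_of_norm_le_const (a := b) (b := a) (f := f)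
      (C := C) (fun v _ => by rw [Real.norm_of_nonneg (hf0 v)]; exact hfC v)
    simpa using this
  have key : ∀ T, 0 ≤ T → ∫ u in (0 : ℝ)..T, Real.exp (-F u) * f u = 1 - Real.exp (-F T) := by
    intro T hT
    have hac : AbsolutelyContinuousOnInterval (fun u => Real.exp (-F u)) 0 T := by
      refine LipschitzOnWith.absolutelyContinuousOnInterval (K := 1 * C) ?_
      rw [uIcc_of_le hT]
      exact hLip.comp hFlip.lipschitzOnWith (fun u hu => hF0 u hu.1)
    have h1 := hac.integral_deriv_eq_sub
    have h2 : ∫ u in (0 : ℝ)..T, deriv (fun u => Real.exp (-F u)) u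
        = ∫ u in (0 : ℝ)..T, -(Real.exp (-F u) * f u) := by
      refine intervalIntegral.integral_congr_ae ?_
      filter_upwards [LocallyIntegrable.ae_hasDerivAt_integral hfl] with u hu _
      have := ((hu 0).neg.exp).deriv
      rw [show deriv (fun u => Real.exp (-F u)) u = _ from this]
      simp [hF]
    rw [h2, intervalIntegral.integral_neg] at h1
    have h3 : F 0 = 0 := by simp [hF]
    rw [h3] at h1
    simp at h1
    linarith
  have keyL : ∀ T, 0 ≤ T → (∫⁻ u in Ioc (0 : ℝ) T, expNeg (∫⁻ v in Ioc 0 u, g v) * g u)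
      + expNeg (∫⁻ v in Ioc 0 T, g v) = 1 := by
    intro T hT
    have h1 : ∫⁻ u in Ioc (0 : ℝ) T, expNeg (∫⁻ v in Ioc 0 u, g v) * g u
        = ∫⁻ u in Ioc (0 : ℝ) T, ENNReal.ofReal (Real.exp (-F u) * f u) := by
      refine setLIntegral_congr_fun measurableSet_Ioc fun u hu => ?_
      rw [hG u hu.1.le, expNeg_ofReal (hF0 u hu.1.le), hgf,
        ENNReal.ofReal_mul (Real.exp_nonneg _)]
    have hint : IntervalIntegrable (fun u => Real.exp (-F u) * f u) volume 0 T :=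
      (hfi 0 T).continuousOn_mul (by fun_prop)
    rw [h1, ← ofReal_integral_eq_lintegral_ofReal hint.1
      (Eventually.of_forall fun u => mul_nonneg (Real.exp_nonneg _) (hf0 u)),
      ← intervalIntegral.integral_of_le hT, key T hT, hG T hT, expNeg_ofReal (hF0 T hT),
      ← ENNReal.ofReal_add _ (Real.exp_nonneg _)]
    · simp
    · simpa using hF0 T hT
  have hU : (⋃ n : ℕ, Ioc (0 : ℝ) n) = Ioi 0 := by
    ext x
    simp only [mem_iUnion, mem_Ioc, mem_Ioi]
    exact ⟨fun ⟨_, h, _⟩ => h, fun h => ⟨⌈x⌉₊, h, Nat.le_ceil x⟩⟩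
  have hmono : Monotone fun n : ℕ => Ioc (0 : ℝ) n := fun m n hmn =>
    Ioc_subset_Ioc_right (by exact_mod_cast hmn)
  have hlim : ∀ φ : ℝ → ℝ≥0∞, Tendsto (fun n : ℕ => ∫⁻ u in Ioc (0 : ℝ) n, φ u) atTop
      (𝓝 (∫⁻ u in Ioi (0 : ℝ), φ u)) := by
    intro φ
    have h1 : ∀ s, MeasurableSet s → ∫⁻ u in s, φ u = (volume.withDensity φ) s := fun s hs =>
      (withDensity_apply φ hs).symm
    rw [← hU, h1 _ (MeasurableSet.iUnion fun n => measurableSet_Ioc)]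
    simp_rw [fun n : ℕ => h1 (Ioc (0 : ℝ) n) measurableSet_Ioc]
    exact tendsto_measure_iUnion_atTop hmono
  have hsum := (hlim fun u => expNeg (∫⁻ v in Ioc 0 u, g v) * g u).add
    ((continuous_expNeg.tendsto _).comp (hlim g))
  refine tendsto_nhds_unique hsum ?_
  refine tendsto_const_nhds.congr fun n => ?_
  exact (keyL n (Nat.cast_nonneg n)).symm

/-! ### The model -/

/-- The primitives of a continuous-time Markov decision process with state space `S` and action
space `A`. The transition rate is a signed kernel given `(x, a) ∈ K`, extended by `0` outside of
the (measurable) set `K`. -/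
structure Model (S A : Type*) [MeasurableSpace S] [MeasurableSpace A] where
  /-- the admissible state-action pairs -/
  K : Set (S × A)
  measurableSet_K : MeasurableSet K
  exists_selector : ∃ φ : S → A, Measurable φ ∧ ∀ x, (x, φ x) ∈ K
  /-- the transition rate `q(dy | x, a)` -/
  q : S → A → SignedMeasure S
  measurable_q : ∀ Γ, MeasurableSet Γ → Measurable fun p : S × A => q p.1 p.2 Γ
  q_eq_zero : ∀ x a, (x, a) ∉ K → q x a = 0
  q_nonneg : ∀ x a, (x, a) ∈ K → ∀ Γ, MeasurableSet Γ → x ∉ Γ → 0 ≤ q x a Γ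
  conservative : ∀ x a, (x, a) ∈ K → q x a univ = 0
  stable : ∀ x, BddAbove ((fun a => -q x a {x}) '' {a | (x, a) ∈ K})

/-- `X` with an isolated point adjoined: `Sum.inr ()` is `x_∞` (for states), resp. `a_∞`
(for actions). -/
abbrev Adjoin (X : Type*) := X ⊕ Unit

namespace Model

variable {S A : Type*} [MeasurableSpace S] [MeasurableSpace A] (M : Model S A)

/-- The set `A(x)` of admissible actions. -/
def adm (x : S) : Set A := {a | (x, a) ∈ M.K}

/-- `q_x(a) = -q({x} | x, a)`. -/
def rate (x : S) (a : A) : ℝ := -M.q x a {x}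

/-- `q̄_x = sup_{a ∈ A(x)} q_x(a)`. -/
def maxRate (x : S) : ℝ := sSup (M.rate x '' M.adm x)

/-- `A(x)` for `x ∈ S`, and `A(x_∞) = {a_∞}`. -/
def admExt : Adjoin S → Set (Adjoin A)
  | Sum.inl x => Sum.inl '' M.adm x
  | Sum.inr _ => {Sum.inr ()}

theorem zero_le_restrict_q (x : S) (a : A) : 0 ≤[{x}ᶜ] M.q x a := by
  refine VectorMeasure.restrict_le_restrict_of_subset_le _ _ fun Γ hΓ hx => ?_
  by_cases h : (x, a) ∈ M.K
  · exact M.q_nonneg x a h Γ hΓ fun hxΓ => hx hxΓ rfl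
  · rw [M.q_eq_zero x a h]

theorem measurable_q_section {D : Set (S × S)} (hD : MeasurableSet D) :
    Measurable fun p : S × A => M.q p.1 p.2 (Prod.mk p.1 ⁻¹' D) := by
  induction D, hD using MeasurableSpace.induction_on_inter generateFrom_prod.symm isPiSystem_prod with
  | empty => simp
  | basic t ht =>
    obtain ⟨B, hB, Γ, hΓ, rfl⟩ := ht
    classical
    have : (fun p : S × A => M.q p.1 p.2 (Prod.mk p.1 ⁻¹' B ×ˢ Γ))
        = fun p => if p.1 ∈ B then M.q p.1 p.2 Γ else 0 := by
      ext p
      rw [mk_preimage_prod_right_eq_if]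
      split_ifs <;> simp
    rw [this]
    exact Measurable.ite (measurable_fst hB) (M.measurable_q Γ hΓ) measurable_const
  | compl t ht ih =>
    have : (fun p : S × A => M.q p.1 p.2 (Prod.mk p.1 ⁻¹' tᶜ))
        = fun p => M.q p.1 p.2 univ - M.q p.1 p.2 (Prod.mk p.1 ⁻¹' t) := by
      ext p
      have h := VectorMeasure.of_add_of_sdiff (v := M.q p.1 p.2)
        (measurable_prodMk_left (x := p.1) ht) MeasurableSet.univ (subset_univ _)
      rw [preimage_compl, compl_eq_univ_sdiff]
      linarith
    rw [this]
    exact (M.measurable_q _ MeasurableSet.univ).sub ih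
  | iUnion f hd hm ih =>
    have h : ∀ p : S × A, HasSum (fun i => M.q p.1 p.2 (Prod.mk p.1 ⁻¹' f i))
        (M.q p.1 p.2 (Prod.mk p.1 ⁻¹' ⋃ i, f i)) := by
      intro p
      rw [preimage_iUnion]
      exact VectorMeasure.hasSum_of_disjoint_iUnion
        (fun i => measurable_prodMk_left (hm i)) fun i j hij => (hd hij).preimage _
    refine measurable_of_tendsto_metrizable (f := fun n (p : S × A) =>
      ∑ i ∈ Finset.range n, M.q p.1 p.2 (Prod.mk p.1 ⁻¹' f i))
      (fun n => Finset.measurable_sum _ fun i _ => ih i) ?_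
    exact tendsto_pi_nhds.2 fun p => (h p).tendsto_sum_nat

variable [StandardBorelSpace S]

/-- The measure `Γ ↦ q(Γ \ {x} | x, a)`. -/
def jump (x : S) (a : A) : Measure S :=
  (M.q x a).toMeasureOfZeroLE {x}ᶜ (measurableSet_singleton x).compl (M.zero_le_restrict_q x a)

theorem jump_apply (x : S) (a : A) {Γ : Set S} (hΓ : MeasurableSet Γ) :
    M.jump x a Γ = ENNReal.ofReal (M.q x a ({x}ᶜ ∩ Γ)) := by
  have := SignedMeasure.toMeasureOfZeroLE_real_apply (M.q x a) (M.zero_le_restrict_q x a)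
    (measurableSet_singleton x).compl hΓ
  rw [← this, measureReal_def, ENNReal.ofReal_toReal]
  · rfl
  · exact measure_ne_top _ _

theorem measurable_jump : Measurable fun p : S × A => M.jump p.1 p.2 := by
  refine Measure.measurable_of_measurable_coe _ fun Γ hΓ => ?_
  simp_rw [M.jump_apply _ _ hΓ]
  have hD : MeasurableSet ({p : S × S | p.2 ≠ p.1} ∩ univ ×ˢ Γ) :=
    ((measurableSet_eq_fun measurable_snd measurable_fst).compl).inter
      (MeasurableSet.univ.prod hΓ)
  refine ENNReal.measurable_ofReal.comp ?_
  convert M.measurable_q_section hD using 4 with p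
  ext y
  simp

theorem jump_univ_le (x : S) (a : A) : M.jump x a univ ≤ ENNReal.ofReal (M.maxRate x) := by
  rw [M.jump_apply _ _ MeasurableSet.univ, inter_univ]
  by_cases h : (x, a) ∈ M.K
  · refine ENNReal.ofReal_le_ofReal ?_
    have h1 := VectorMeasure.of_add_of_sdiff (v := M.q x a)
      (measurableSet_singleton x) MeasurableSet.univ (subset_univ _)
    rw [M.conservative x a h, ← compl_eq_univ_sdiff] at h1
    have h2 : M.rate x a ≤ M.maxRate x := le_csSup (M.stable x) ⟨a, h, rfl⟩
    simp only [rate] at h2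
    linarith
  · simp [M.q_eq_zero x a h]

/-- `jump`, extended by the zero measure to `x_∞` and `a_∞`. -/
def jumpExt : Adjoin S → Adjoin A → Measure S
  | Sum.inl x, Sum.inl a => M.jump x a
  | _, _ => 0

theorem measurable_jumpExt : Measurable fun p : Adjoin S × Adjoin A => M.jumpExt p.1 p.2 := by
  have he : MeasurableEmbedding (Prod.map Sum.inl Sum.inl : S × A → Adjoin S × Adjoin A) :=
    MeasurableEmbedding.prodMap ⟨Sum.inl_injective, measurable_inl, fun _ h => h.inl_image⟩
      ⟨Sum.inl_injective, measurable_inl, fun _ h => h.inl_image⟩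
  have : (fun p : Adjoin S × Adjoin A => M.jumpExt p.1 p.2)
      = Function.extend (Prod.map Sum.inl Sum.inl) (fun p : S × A => M.jump p.1 p.2)
        fun _ => 0 := by
    ext1 p
    rcases p with ⟨x | x, a | a⟩
    · exact (he.injective.extend_apply (fun p : S × A => M.jump p.1 p.2) (fun _ => 0) (x, a)).symm
    all_goals
      rw [Function.extend_apply']
      · rfl
      · rintro ⟨⟨y, b⟩, hyb⟩
        simp at hyb
  rw [this]
  exact he.measurable_extend M.measurable_jump measurable_const

end Model

/-! ### The canonical space of the controlled process -/

section Paths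

variable (S : Type*)

/-- A pair `(θ_n, x_n)` of a sojourn time and the subsequent state. -/
abbrev Mark := ℝ≥0∞ × Adjoin S

/-- The pair `(∞, x_∞)`. -/
def cemetery : Mark S := (∞, Sum.inr ())

variable {S}

/-- The sequences `(x_0, θ_1, x_1, θ_2, x_2, …)` with `x_0 ∈ S` such that either all `θ_n` lie in
`(0, ∞)` and all `x_n` in `S`, or this is so up to some index and all later pairs `(θ_n, x_n)` are
`(∞, x_∞)`. For uniformity the sequence starts with a dummy `θ_0 = 0`. -/
structure IsPath (ω : ℕ → Mark S) : Prop where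
  zero : (ω 0).1 = 0 ∧ (ω 0).2 ∈ range Sum.inl
  succ : ∀ n, ((ω (n + 1)).1 ∈ Ioo 0 ∞ ∧ (ω (n + 1)).2 ∈ range Sum.inl) ∨
    ω (n + 1) = cemetery S
  absorb : ∀ n, ω n = cemetery S → ω (n + 1) = cemetery S

variable (S) in
/-- The sample space `Ω`. -/
abbrev PathSpace := {ω : ℕ → Mark S // IsPath ω}

namespace PathSpace

/-- The state `x_m` after the `m`-th jump. -/
def state (m : ℕ) (ω : PathSpace S) : Adjoin S := (ω.1 m).2

/-- The jump moment `T_m = θ_1 + ⋯ + θ_m`. -/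
def jumpTime (m : ℕ) (ω : PathSpace S) : ℝ≥0∞ := ∑ i ∈ Finset.range (m + 1), (ω.1 i).1

open Classical in
/-- The process `ξ_t`: it is `x_m` on `T_m ≤ t < T_{m+1}`, and `x_∞` from `T_∞ = lim T_m` on. -/
def process (t : ℝ≥0) (ω : PathSpace S) : Adjoin S :=
  if h : ∃ m, jumpTime m ω ≤ t ∧ t < jumpTime (m + 1) ω then state (Nat.find h) ω
  else Sum.inr ()

open Classical in
/-- The process `ξ_{t-}`: it is `x_m` on `T_m < t ≤ T_{m+1}`, it is `x_0` at `t = 0`, and `x_∞`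
from `T_∞` on. -/
def leftProcess (t : ℝ≥0) (ω : PathSpace S) : Adjoin S :=
  if t = 0 then state 0 ω
  else if h : ∃ m, jumpTime m ω < t ∧ t ≤ jumpTime (m + 1) ω then state (Nat.find h) ω
  else Sum.inr ()

variable [MeasurableSpace S]

theorem measurable_state (m : ℕ) : Measurable (state m : PathSpace S → Adjoin S) :=
  measurable_snd.comp ((measurable_pi_apply m).comp measurable_subtype_coe)

theorem measurable_jumpTime (m : ℕ) : Measurable (jumpTime m : PathSpace S → ℝ≥0∞) :=
  Finset.measurable_sum _ fun i _ =>
    measurable_fst.comp ((measurable_pi_apply i).comp measurable_subtype_coe)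

variable (S) in
/-- The filtration `F_t = σ({T_m ≤ s, x_m ∈ Γ} : Γ ∈ B(S), s ≤ t, m ≥ 0)`. -/
def filtration : Filtration ℝ≥0 (inferInstance : MeasurableSpace (PathSpace S)) where
  seq t := MeasurableSpace.generateFrom {B | ∃ (m : ℕ) (s : ℝ≥0) (Γ : Set S), s ≤ t ∧
    MeasurableSet Γ ∧ B = {ω | jumpTime m ω ≤ s ∧ state m ω ∈ Sum.inl '' Γ}}
  mono' := by
    intro t t' htt'
    refine MeasurableSpace.generateFrom_mono ?_
    rintro B ⟨m, s, Γ, hs, hΓ, rfl⟩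
    exact ⟨m, s, Γ, hs.trans htt', hΓ, rfl⟩
  le' := by
    intro t
    refine MeasurableSpace.generateFrom_le ?_
    rintro B ⟨m, s, Γ, -, hΓ, rfl⟩
    exact (measurableSet_le (measurable_jumpTime m) measurable_const).inter
      (measurable_state m hΓ.inl_image)

variable (S) in
theorem predictable_le :
    (filtration S).predictable ≤ (inferInstance : MeasurableSpace (ℝ≥0 × PathSpace S)) :=
  measurableSpace_le_predictable_of_measurableSet
    (fun _ h => (measurableSet_singleton _).prod ((filtration S).le _ _ h))
    (fun _ _ h => measurableSet_Ioi.prod ((filtration S).le _ _ h))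

end PathSpace

/-- The histories `(θ_0, x_0, θ_1, x_1, …, θ_k, x_k)`, where `θ_0 = 0` is the dummy. -/
abbrev Hist (S : Type*) (k : ℕ) := (i : Finset.Iic k) → Mark S

/-- The sequence `(x_0, θ_1, x_1, …, θ_k, x_k, ∞, x_∞, ∞, x_∞, …)`. -/
def Hist.extend {k : ℕ} (h : Hist S k) : ℕ → Mark S :=
  fun n => if hn : n ≤ k then h ⟨n, Finset.mem_Iic.2 hn⟩ else cemetery S

/-- The last state `x_k` of a history. -/
def Hist.last {k : ℕ} (h : Hist S k) : Adjoin S := (h ⟨k, Finset.mem_Iic.2 le_rfl⟩).2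

theorem Hist.measurable_extend [MeasurableSpace S] (k : ℕ) :
    Measurable (Hist.extend : Hist S k → ℕ → Mark S) := by
  refine measurable_pi_lambda _ fun n => ?_
  unfold Hist.extend
  split_ifs with hn
  · exact measurable_pi_apply _
  · exact measurable_const

theorem Hist.measurable_last [MeasurableSpace S] (k : ℕ) :
    Measurable (Hist.last : Hist S k → Adjoin S) :=
  measurable_snd.comp (measurable_pi_apply _)

theorem measurableSet_isPath [MeasurableSpace S] : MeasurableSet {ω : ℕ → Mark S | IsPath ω} := by
  have hc : ∀ n, MeasurableSet {ω : ℕ → Mark S | ω n = cemetery S} := by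
    intro n
    have h1 : MeasurableSet {p : Mark S | p = cemetery S} := by
      convert (measurableSet_singleton (∞ : ℝ≥0∞)).prod
        (measurableSet_range_inr : MeasurableSet (range Sum.inr : Set (Adjoin S))) using 1
      ext ⟨t, x⟩
      rcases x with x | x <;> simp [cemetery]
    exact (measurable_pi_apply (X := fun _ : ℕ => Mark S) n) h1
  have h2 : ∀ n, MeasurableSet {ω : ℕ → Mark S | (ω n).2 ∈ range Sum.inl} := fun n =>
    (measurable_snd.comp (measurable_pi_apply n)) measurableSet_range_inl
  have h1 : ∀ n, Measurable fun ω : ℕ → Mark S => (ω n).1 := fun n =>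
    measurable_fst.comp (measurable_pi_apply n)
  have : {ω : ℕ → Mark S | IsPath ω} =
      ({ω | (ω 0).1 = 0} ∩ {ω | (ω 0).2 ∈ range Sum.inl}) ∩
      (⋂ n, ({ω | (ω (n + 1)).1 ∈ Ioo 0 ∞} ∩ {ω | (ω (n + 1)).2 ∈ range Sum.inl}) ∪
        {ω | ω (n + 1) = cemetery S}) ∩
      ⋂ n, ({ω | ω n = cemetery S}ᶜ ∪ {ω | ω (n + 1) = cemetery S}) := by
    ext ω
    simp only [mem_ofPred_eq, mem_inter_iff, mem_iInter, mem_union, mem_compl_iff,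
      ← imp_iff_not_or]
    exact ⟨fun h => ⟨⟨h.zero, h.succ⟩, h.absorb⟩, fun h => ⟨h.1.1, h.1.2, h.2⟩⟩
  rw [this]
  refine MeasurableSet.inter (MeasurableSet.inter ?_ ?_) ?_
  · exact (h1 0 (measurableSet_singleton 0)).inter (h2 0)
  · exact MeasurableSet.iInter fun n =>
      ((h1 (n + 1) measurableSet_Ioo).inter (h2 (n + 1))).union (hc (n + 1))
  · exact MeasurableSet.iInter fun n => (hc n).compl.union (hc (n + 1))

end Paths

/-! ### Policies and the law of the controlled process -/

variable {S A : Type*} [MeasurableSpace S] [MeasurableSpace A]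

/-- A randomized history-dependent policy `π(· | ω, t)`: a transition probability from
`Ω × [0, ∞)` with the predictable σ-algebra to `A ∪ {a_∞}`, concentrated on `A(ξ_{t-})`. -/
structure Policy (M : Model S A) where
  /-- the probability measure `π(· | ω, t)` -/
  prob : ℝ≥0 → PathSpace S → Measure (Adjoin A)
  isProbabilityMeasure : ∀ t ω, IsProbabilityMeasure (prob t ω)
  predictable : ∀ B, MeasurableSet B →
    Measurable[(PathSpace.filtration S).predictable] fun p : ℝ≥0 × PathSpace S => prob p.1 p.2 B
  concentrated : ∀ t ω, prob t ω (M.admExt (PathSpace.leftProcess t ω))ᶜ = 0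

namespace Policy

variable {M : Model S A} (π : Policy M)

theorem measurable_prob : Measurable fun p : ℝ≥0 × PathSpace S => π.prob p.1 p.2 :=
  Measure.measurable_of_measurable_coe _ fun B hB =>
    (π.predictable B hB).mono (PathSpace.predictable_le S) le_rfl

open Classical in
/-- `π(· | x_0, θ_1, …, θ_k, x_k, T_k + u)`: the action distribution at time `T_k + u` when the
`(k+1)`-st jump has not occurred before that time. By predictability it can be read off from the
path that has no further jump after the history `h`. (It is set to `0` on sequences which are not
histories of paths; these have probability zero.) -/
def histProb (k : ℕ) (h : Hist S k) (u : ℝ) : Measure (Adjoin A) :=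
  if hp : IsPath h.extend then
    π.prob ((PathSpace.jumpTime k ⟨h.extend, hp⟩).toNNReal + u.toNNReal) ⟨h.extend, hp⟩
  else 0

theorem measurable_histProb (k : ℕ) :
    Measurable fun p : Hist S k × ℝ => π.histProb k p.1 p.2 := by
  classical
  have hs : MeasurableSet {p : Hist S k × ℝ | IsPath p.1.extend} :=
    ((Hist.measurable_extend k).comp measurable_fst) measurableSet_isPath
  have hω : Measurable fun p : {p : Hist S k × ℝ | IsPath p.1.extend} =>
      (⟨p.1.1.extend, p.2⟩ : PathSpace S) :=
    (((Hist.measurable_extend k).comp measurable_fst).comp measurable_subtype_coe).subtype_mk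
  refine Measurable.dite (s := {p : Hist S k × ℝ | IsPath p.1.extend})
    (f := fun p => π.prob ((PathSpace.jumpTime k ⟨p.1.1.extend, p.2⟩).toNNReal
      + p.1.2.toNNReal) ⟨p.1.1.extend, p.2⟩) (g := fun _ => 0) ?_ measurable_const hs
  refine π.measurable_prob.comp (Measurable.prodMk ?_ hω)
  exact (((PathSpace.measurable_jumpTime k).comp hω).ennreal_toNNReal).add
    (measurable_snd.comp measurable_subtype_coe).real_toNNReal

theorem histProb_univ_le (k : ℕ) (h : Hist S k) (u : ℝ) : π.histProb k h u univ ≤ 1 := by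
  unfold histProb
  split_ifs
  · have := π.isProbabilityMeasure
    exact prob_le_one
  · simp

/-- `histProb` as a kernel. -/
def histKernel (k : ℕ) : Kernel (Hist S k × ℝ) (Adjoin A) where
  toFun p := π.histProb k p.1 p.2
  measurable' := π.measurable_histProb k

instance (k : ℕ) : IsFiniteKernel (π.histKernel k) :=
  ⟨⟨1, by simp, fun p => π.histProb_univ_le k p.1 p.2⟩⟩

variable [StandardBorelSpace S]

/-- The jump intensity given the history, the kernel
`Λ^k(Γ | x_0, θ_1, …, θ_k, x_k, u) = ∫_A π(da | x_0, θ_1, …, x_k, T_k + u) q(Γ \ {x_k} | x_k, a)`.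
It vanishes if `x_k = x_∞`, that is, if `θ_k = ∞`. -/
def intensity (k : ℕ) : Kernel (Hist S k × ℝ) S where
  toFun p := (π.histProb k p.1 p.2).bind fun a => M.jumpExt p.1.last a
  measurable' := by
    refine Measure.measurable_of_measurable_coe _ fun Γ hΓ => ?_
    have hm : Measurable fun p : (Hist S k × ℝ) × Adjoin A => M.jumpExt p.1.1.last p.2 :=
      M.measurable_jumpExt.comp
        (((Hist.measurable_last k).comp (measurable_fst.comp measurable_fst)).prodMk measurable_snd)
    have h1 : ∀ p : Hist S k × ℝ,
        ((π.histProb k p.1 p.2).bind fun a => M.jumpExt p.1.last a) Γ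
          = ∫⁻ a, M.jumpExt p.1.last a Γ ∂(π.histKernel k p) := fun p =>
      Measure.bind_apply hΓ (hm.comp measurable_prodMk_left).aemeasurable
    simp_rw [h1]
    exact Measurable.lintegral_kernel_prod_right' (κ := π.histKernel k)
      ((Measure.measurable_coe hΓ).comp hm)

/-- For a given history, the total jump intensity is bounded in time. -/
theorem intensity_bounded (k : ℕ) (h : Hist S k) :
    ∃ C : ℝ≥0, ∀ u, π.intensity k (h, u) univ ≤ C := by
  have hm : Measurable fun a => M.jumpExt h.last a :=
    M.measurable_jumpExt.comp measurable_prodMk_left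
  obtain ⟨C, hC⟩ : ∃ C : ℝ≥0, ∀ a, M.jumpExt h.last a univ ≤ C := by
    rcases h.last with x | x
    · refine ⟨(M.maxRate x).toNNReal, fun a => ?_⟩
      rcases a with a | a
      · exact M.jump_univ_le x a
      · simp [Model.jumpExt]
    · exact ⟨0, fun a => by simp [Model.jumpExt]⟩
  refine ⟨C, fun u => ?_⟩
  change ((π.histProb k h u).bind fun a => M.jumpExt h.last a) univ ≤ C
  rw [Measure.bind_apply MeasurableSet.univ hm.aemeasurable]
  calc ∫⁻ a, M.jumpExt h.last a univ ∂(π.histProb k h u)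
      ≤ ∫⁻ _, C ∂(π.histProb k h u) := lintegral_mono hC
    _ ≤ C := by
      rw [lintegral_const]
      exact mul_le_of_le_one_right zero_le (π.histProb_univ_le k h u)

instance (k : ℕ) : IsSFiniteKernel (π.intensity k) :=
  isSFiniteKernel_of_finite _ fun p => by
    obtain ⟨C, hC⟩ := π.intensity_bounded k p.1
    exact (hC p.2).trans_lt ENNReal.coe_lt_top

/-- `∫_{(0,u]} Λ^k(S | h, v) dv`. -/
def cumIntensity (k : ℕ) (h : Hist S k) (u : ℝ) : ℝ≥0∞ :=
  ∫⁻ v in Ioc 0 u, π.intensity k (h, v) univ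

/-- `∫_{(0,∞)} Λ^k(S | h, v) dv`. -/
def totalIntensity (k : ℕ) (h : Hist S k) : ℝ≥0∞ :=
  ∫⁻ v in Ioi 0, π.intensity k (h, v) univ

theorem measurable_cumIntensity (k : ℕ) :
    Measurable fun p : Hist S k × ℝ => π.cumIntensity k p.1 p.2 := by
  have h1 : (fun p : Hist S k × ℝ => π.cumIntensity k p.1 p.2) = fun p =>
      ∫⁻ v, {z : (Hist S k × ℝ) × ℝ | 0 < z.2 ∧ z.2 ≤ z.1.2}.indicator
        (fun z => π.intensity k (z.1.1, z.2) univ) (p, v) := by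
    ext p
    rw [cumIntensity, ← lintegral_indicator measurableSet_Ioc]
    rfl
  rw [h1]
  refine Measurable.lintegral_prod_right' (Measurable.indicator ?_ ?_)
  · exact ((π.intensity k).measurable_coe MeasurableSet.univ).comp
      ((measurable_fst.comp measurable_fst).prodMk measurable_snd)
  · exact (measurableSet_lt measurable_const measurable_snd).inter
      (measurableSet_le measurable_snd (measurable_snd.comp measurable_fst))

theorem measurable_totalIntensity (k : ℕ) : Measurable (π.totalIntensity k) :=
  ((π.intensity k).measurable_coe MeasurableSet.univ).lintegral_prod_right'

/-- The conditional law of `(θ_{k+1}, x_{k+1})` given the history `h = (x_0, θ_1, …, θ_k, x_k)`: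
on `(0, ∞) × S` it is `Λ^k(dy | h, u) e^{-∫_0^u Λ^k(S | h, v) dv} du`, and the mass of
`(∞, x_∞)` is `e^{-∫_0^∞ Λ^k(S | h, v) dv}`. If `θ_k = ∞` then `Λ^k = 0`, so that this is the
point mass at `(∞, x_∞)`. -/
def stepKernel (k : ℕ) : Kernel (Hist S k) (Mark S) :=
  ((Kernel.const (Hist S k) (volume.restrict (Ioi (0 : ℝ))) ⊗ₖ π.intensity k).withDensity
      (fun h p => expNeg (π.cumIntensity k h p.1))).map
    (fun p => (ENNReal.ofReal p.1, Sum.inl p.2)) +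
  (Kernel.const (Hist S k) (Measure.dirac (cemetery S))).withDensity
    (fun h _ => expNeg (π.totalIntensity k h))

instance (k : ℕ) : IsMarkovKernel (π.stepKernel k) := by
  refine ⟨fun h => ⟨?_⟩⟩
  obtain ⟨C, hC⟩ := π.intensity_bounded k h
  have hmap : Measurable fun p : ℝ × S => ((ENNReal.ofReal p.1, Sum.inl p.2) : Mark S) :=
    (ENNReal.measurable_ofReal.comp measurable_fst).prodMk (measurable_inl.comp measurable_snd)
  have hd : Measurable (Function.uncurry fun (h : Hist S k) (p : ℝ × S) =>
      expNeg (π.cumIntensity k h p.1)) :=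
    measurable_expNeg.comp ((π.measurable_cumIntensity k).comp
      (measurable_fst.prodMk (measurable_fst.comp measurable_snd)))
  have hd2 : Measurable (Function.uncurry fun (h : Hist S k) (_ : Mark S) =>
      expNeg (π.totalIntensity k h)) :=
    measurable_expNeg.comp ((π.measurable_totalIntensity k).comp measurable_fst)
  have hg : Measurable fun v : ℝ => π.intensity k (h, v) univ :=
    ((π.intensity k).measurable_coe MeasurableSet.univ).comp measurable_prodMk_left
  rw [stepKernel, _root_.add_apply, Measure.add_apply, Kernel.map_apply' _ hmap _ MeasurableSet.univ,
    preimage_univ, Kernel.withDensity_apply' _ hd, Kernel.withDensity_apply' _ hd2,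
    setLIntegral_univ, setLIntegral_univ, Kernel.lintegral_compProd _ _ _
      (f := fun p => expNeg (π.cumIntensity k h p.1)) (hd.comp measurable_prodMk_left)]
  rw [← lintegral_hazard hg hC]
  simp only [Kernel.const_apply, lintegral_const, measure_univ, mul_one]
  rfl

/-- The probability measure `P_γ^π` on `Ω`: the law, given by the Ionescu-Tulcea theorem, of the
sequence `(θ_0, x_0), (θ_1, x_1), …` with `θ_0 = 0`, `x_0 ∼ γ` and the conditional laws
`stepKernel`. It is concentrated on the set of paths, and hence a measure on `Ω`. -/
def law (γ : Measure S) : Measure (PathSpace S) :=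
  (Kernel.trajMeasure (X := fun _ => Mark S) (γ.map fun x => ((0, Sum.inl x) : Mark S))
    π.stepKernel).comap Subtype.val

/-- `P_x^π`. -/
def lawFrom (x : S) : Measure (PathSpace S) := π.law (Measure.dirac x)

end Policy

/-! ### The conditions and the terms of the formulas -/

namespace Model

variable (M : Model S A)

/-- A measurable function `f` satisfies `∫_S q(dy | x, a) f(y) ≤ ρ f(x) + b` for all `x ∈ S` and
`a ∈ A(x)`; the integral is finite. -/
def DriftBound (f : S → ℝ) (ρ b : ℝ) : Prop :=
  ∀ x, ∀ a ∈ M.adm x, (M.q x a).Integrable f ∧ ∫ᵛ y, f y ∂<•(M.q x a) ≤ ρ * f x + b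

/-- The Lyapunov condition on the weight function `w`. -/
structure IsLyapunov (w : S → ℝ) : Prop where
  measurable : Measurable w
  one_le : ∀ x, 1 ≤ w x
  exists_bounds : ∃ ρ b : ℝ, ∃ Sl : ℕ → Set S, 0 ≤ ρ ∧ 0 ≤ b ∧
    (∀ l, MeasurableSet (Sl l)) ∧ Monotone Sl ∧ ⋃ l, Sl l = univ ∧
    Tendsto (fun l => ⨅ x ∈ (Sl l)ᶜ, (w x : EReal)) atTop (𝓝 ⊤) ∧
    M.DriftBound w ρ b ∧
    ∀ l, BddAbove (M.maxRate '' Sl l)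

/-- The condition on the second weight function `w'`, given the first one, `w`. -/
structure IsSecondWeight (w w' : S → ℝ) : Prop where
  measurable : Measurable w'
  one_le : ∀ x, 1 ≤ w' x
  exists_bounds : ∃ L ρ b : ℝ, 0 ≤ L ∧ 0 ≤ ρ ∧ 0 ≤ b ∧
    (∀ x, (M.maxRate x + 1) * w' x ≤ L * w x) ∧
    M.DriftBound w' ρ b

/-- `∫_S q(dy | x, a) u(y)` as a function of `x` and `a`, extended by zero to `x_∞` and `a_∞`. -/
def generator (u : S → ℝ) : Adjoin S → Adjoin A → ℝ
  | Sum.inl x, Sum.inl a => ∫ᵛ y, u y ∂<•(M.q x a)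
  | _, _ => 0

end Model

/-- The space `B_w(S)` of measurable functions with finite `w`-weighted norm. -/
def WeightedBounded (w u : S → ℝ) : Prop :=
  Measurable u ∧ BddAbove (range fun x => |u x| / w x)

/-- A function on `S`, extended by zero to `x_∞`. -/
def extendZero (u : S → ℝ) : Adjoin S → ℝ := Sum.elim u fun _ => 0

/-- `∫_A π(da | ω, v) ∫_S q(dy | ξ_v, a) u(y)`. -/
def Policy.drift {M : Model S A} (π : Policy M) (u : S → ℝ) (v : ℝ≥0) (ω : PathSpace S) : ℝ :=
  ∫ a, M.generator u (PathSpace.process v ω) a ∂(π.prob v ω)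

end CTMDP

end

open CTMDP

/-! Dynkin's formula is a telescoping sum, compensated jump by jump. On a path with finitely many
jumps up to time t, f(ξ_t) - f(x_0) is the sum of f(x_{k+1}) - f(x_k) over these jumps
(`telescope`). Given the history up to T_k, the next mark has hazard measure Λ^k, so a nonnegative
function of the jump (x_k, x_{k+1}), restricted to T_{k+1} ≤ t, has the same expectation as its
integral against Λ^k over the part of (T_k, T_{k+1}) before t (`lintegral_jump`). Since π is
predictable, Λ^k is there the rate computed from π(· | ω, v) and ξ_v; the pieces glue into one
integral over (0, t] (`lintegral_tsum_jump`). As q(· | x, a) is the jump measure minus q_x(a) times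
the point mass at x, the difference of the compensators of the states after and before the jumps is
the drift.

Telescoping needs non-explosion (`ae_exists_jumpTime`). Because w ≥ 1, the drift condition takes the
multiplicative form ∫ w d(jump) ≤ (rate + c) w with c = ρ + b. Raising the hazard rate by c then
shows that e^{c(t - T_k)} w(x_k) on T_k ≤ t, with w frozen at the last jump before t, does not
increase in mean along the jumps. Hence w(x_n) on T_n ≤ t and w(ξ_t) both have expectation at most
e^{ct} w(x). If the process exploded by time t, Fatou's lemma would put infinitely many x_n into one
set S_l; but rates are bounded on S_l, so only finitely many jumps up to t leave from it.

The identities are first proved in [0, ∞], with all terms added and none subtracted, so that no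
integrability is needed (`lintegral_process_add`). The second weight bounds u, even multiplied by a
jump rate, by a multiple of w (`IsSecondWeight.exists_bound`); all terms are then finite, and the
identities for the positive and negative parts of u may be subtracted. The discounted formula
follows because E[u(ξ_v)] is u(x) plus a primitive of the expected drift, by integrating against
e^{-αv} by parts. -/

noncomputable section

namespace CTMDP

/-! ### Transition rates: the jump part, the diagonal part, and the drift condition. -/

section

namespace Model

/-- A function on `S` as a `[0, ∞]`-valued function on `S ∪ {x_∞}`, zero at `x_∞`. -/
def ennExt {S : Type*} (f : S → ℝ) : Adjoin S → ℝ≥0∞ :=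
  Sum.elim (fun x => ENNReal.ofReal (f x)) fun _ => 0

theorem measurable_ennExt {S : Type*} [MeasurableSpace S] {f : S → ℝ} (hf : Measurable f) :
    Measurable (ennExt f) :=
  hf.ennreal_ofReal.sumElim measurable_const

variable {S A : Type*} [MeasurableSpace S] [MeasurableSpace A] [StandardBorelSpace S]
  (M : Model S A)

instance isFiniteMeasure_jump (x : S) (a : A) : IsFiniteMeasure (M.jump x a) :=
  ⟨(M.jump_univ_le x a).trans_lt ENNReal.ofReal_lt_top⟩

theorem q_inter_compl_nonneg (x : S) (a : A) {Γ : Set S} (hΓ : MeasurableSet Γ) :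
    0 ≤ M.q x a ({x}ᶜ ∩ Γ) := by
  by_cases h : (x, a) ∈ M.K
  · exact M.q_nonneg x a h _ ((measurableSet_singleton x).compl.inter hΓ) (by simp)
  · simp [M.q_eq_zero x a h]

/-- Splitting off the atom at x, the only place where q(· | x, a) can be negative, reduces integrals
against the signed measure to integrals against the positive measure `jump`. -/
theorem q_eq_jump_add_dirac (x : S) (a : A) :
    M.q x a = (M.jump x a).toSignedMeasure + VectorMeasure.dirac x (M.q x a {x}) := by
  ext Γ hΓ
  rw [_root_.add_apply, Measure.toSignedMeasure_apply_measurable hΓ, measureReal_def,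
    M.jump_apply x a hΓ, ENNReal.toReal_ofReal (M.q_inter_compl_nonneg x a hΓ)]
  have h := VectorMeasure.of_union (v := M.q x a) (A := {x}ᶜ ∩ Γ) (B := {x} ∩ Γ)
    (disjoint_compl_left.mono inter_subset_left inter_subset_left)
    ((measurableSet_singleton x).compl.inter hΓ) ((measurableSet_singleton x).inter hΓ)
  rw [← union_inter_distrib_right, compl_union_self, univ_inter] at h
  rw [h]
  by_cases hx : x ∈ Γ
  · rw [VectorMeasure.dirac_apply_of_mem hΓ hx, inter_eq_left.2 (singleton_subset_iff.2 hx)]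
  · rw [VectorMeasure.dirac_apply_of_notMem hx, singleton_inter_eq_empty.2 hx]
    simp

theorem jump_le_variation (x : S) (a : A) : M.jump x a ≤ (M.q x a).variation := by
  refine Measure.le_iff.2 fun Γ hΓ => ?_
  rw [M.jump_apply x a hΓ, ← Real.enorm_of_nonneg (M.q_inter_compl_nonneg x a hΓ)]
  exact (VectorMeasure.enorm_measure_le_variation _ _).trans (measure_mono inter_subset_right)

theorem integrable_dirac_q (x : S) (c : ℝ) (f : S → ℝ) :
    (VectorMeasure.dirac x c).Integrable f := by
  rw [VectorMeasure.Integrable, VectorMeasure.variation_dirac]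
  exact (integrable_dirac (by simp)).smul_measure (by simp)

/-- The two measures differ by a finite atom, against which every function is integrable. -/
theorem integrable_q_iff (x : S) (a : A) (f : S → ℝ) :
    (M.q x a).Integrable f ↔ Integrable f (M.jump x a) := by
  refine ⟨fun h => h.mono_measure (M.jump_le_variation x a), fun h => ?_⟩
  rw [M.q_eq_jump_add_dirac x a]
  refine VectorMeasure.Integrable.add_vectorMeasure ?_ (integrable_dirac_q _ _ _)
  rwa [VectorMeasure.Integrable, Measure.variation_toSignedMeasure]

theorem integral_q {x : S} {a : A} {f : S → ℝ} (h : Integrable f (M.jump x a)) :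
    ∫ᵛ y, f y ∂<•(M.q x a) = ∫ y, f y ∂(M.jump x a) - M.rate x a * f x := by
  have h1 : (M.jump x a).toSignedMeasure.Integrable f := by
    rwa [VectorMeasure.Integrable, Measure.variation_toSignedMeasure]
  rw [M.q_eq_jump_add_dirac x a, VectorMeasure.integral_add_vectorMeasure h1
    (integrable_dirac_q _ _ _), VectorMeasure.integral_toSignedMeasure,
    VectorMeasure.integral_dirac]
  simp [rate]

theorem q_compl_singleton (x : S) (a : A) : M.q x a {x}ᶜ = M.rate x a := by
  by_cases h : (x, a) ∈ M.K
  · have h1 := VectorMeasure.of_add_of_sdiff (v := M.q x a)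
      (measurableSet_singleton x) MeasurableSet.univ (subset_univ _)
    rw [M.conservative x a h, ← compl_eq_univ_sdiff] at h1
    rw [rate]
    linarith
  · simp [rate, M.q_eq_zero x a h]

theorem rate_nonneg (x : S) (a : A) : 0 ≤ M.rate x a := by
  simpa [q_compl_singleton] using M.q_inter_compl_nonneg x a MeasurableSet.univ

theorem jump_univ (x : S) (a : A) : M.jump x a univ = ENNReal.ofReal (M.rate x a) := by
  rw [M.jump_apply x a MeasurableSet.univ, inter_univ, q_compl_singleton]

theorem jump_eq_zero {x : S} {a : A} (h : a ∉ M.adm x) : M.jump x a = 0 := by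
  rw [← Measure.measure_univ_eq_zero, jump_univ, rate, M.q_eq_zero x a h]
  simp

theorem maxRate_nonneg (x : S) : 0 ≤ M.maxRate x := by
  obtain ⟨φ, -, hφ⟩ := M.exists_selector
  exact (M.rate_nonneg x (φ x)).trans (le_csSup (M.stable x) ⟨φ x, hφ x, rfl⟩)

/-- Since f ≥ 1, the constant b is at most b f(x) and the affine drift bound becomes multiplicative.
In this form the constant can be added to the hazard rate, which is how the exponential growth bound
arises. -/
theorem lintegral_jump_le {f : S → ℝ} {ρ b : ℝ} (hf1 : ∀ x, 1 ≤ f x)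
    (hb : 0 ≤ b) (h : M.DriftBound f ρ b) (x : S) (a : A) :
    ∫⁻ y, ENNReal.ofReal (f y) ∂(M.jump x a)
      ≤ (M.jump x a univ + ENNReal.ofReal (ρ + b)) * ENNReal.ofReal (f x) := by
  by_cases ha : a ∈ M.adm x
  · obtain ⟨h1, h2⟩ := h x a ha
    rw [integrable_q_iff] at h1
    rw [M.integral_q h1] at h2
    rw [← ofReal_integral_eq_lintegral_ofReal h1
      (Eventually.of_forall fun y => zero_le_one.trans (hf1 y)), M.jump_univ]
    have h3 := hf1 x
    -- The sign of ρ is not assumed; if ρ + b < 0 its truncation `ENNReal.ofReal` is 0, which only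
    -- weakens the bound.
    rcases le_or_gt 0 (ρ + b) with h4 | h4
    · rw [← ENNReal.ofReal_add (M.rate_nonneg x a) h4,
        ← ENNReal.ofReal_mul (add_nonneg (M.rate_nonneg x a) h4)]
      refine ENNReal.ofReal_le_ofReal ?_
      nlinarith
    · rw [ENNReal.ofReal_of_nonpos h4.le, add_zero, ← ENNReal.ofReal_mul (M.rate_nonneg x a)]
      refine ENNReal.ofReal_le_ofReal ?_
      nlinarith
  · simp [M.jump_eq_zero ha]

theorem lintegral_jumpExt_le {f : S → ℝ} {ρ b : ℝ} (hf1 : ∀ x, 1 ≤ f x)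
    (hb : 0 ≤ b) (h : M.DriftBound f ρ b) (z : Adjoin S) (a : Adjoin A) :
    ∫⁻ y, ennExt f (Sum.inl y) ∂(M.jumpExt z a)
      ≤ (M.jumpExt z a univ + ENNReal.ofReal (ρ + b)) * ennExt f z := by
  rcases z with x | x <;> rcases a with a | a
  · exact M.lintegral_jump_le hf1 hb h x a
  all_goals simp [jumpExt]

/-- `jumpExt` as a kernel. -/
def jumpKernel : Kernel (Adjoin S × Adjoin A) S where
  toFun p := M.jumpExt p.1 p.2
  measurable' := M.measurable_jumpExt

theorem jumpExt_univ_le (z : Adjoin S) (a : Adjoin A) :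
    M.jumpExt z a univ ≤ ennExt M.maxRate z := by
  rcases z with x | x <;> rcases a with a | a
  · exact M.jump_univ_le x a
  all_goals simp [jumpExt]

instance : IsSFiniteKernel M.jumpKernel :=
  isSFiniteKernel_of_finite _ fun p => by
    refine (M.jumpExt_univ_le p.1 p.2).trans_lt ?_
    rcases p.1 with x | x <;> simp [ennExt]

instance isFiniteMeasure_jumpExt (z : Adjoin S) (a : Adjoin A) : IsFiniteMeasure (M.jumpExt z a) :=
  ⟨(M.jumpExt_univ_le z a).trans_lt (by rcases z with x | x <;> simp [ennExt])⟩

theorem measurable_lintegral_jumpExt {G : Adjoin S × Adjoin S → ℝ≥0∞} (hG : Measurable G) :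
    Measurable fun p : Adjoin S × Adjoin A => ∫⁻ y, G (p.1, Sum.inl y) ∂(M.jumpExt p.1 p.2) :=
  Measurable.lintegral_kernel_prod_right' (κ := M.jumpKernel)
    (f := fun z => G (z.1.1, Sum.inl z.2))
    (hG.comp ((measurable_fst.comp measurable_fst).prodMk (measurable_inl.comp measurable_snd)))

end Model

end

/-! ### The law of one sojourn, and the law of the whole sequence of marks. -/

section

theorem expNeg_add (a b : ℝ≥0∞) : expNeg (a + b) = expNeg a * expNeg b := by
  rw [expNeg, expNeg, expNeg, ← EReal.exp_add, EReal.coe_ennreal_add,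
    EReal.neg_add (Or.inl (by simp)) (Or.inr (by simp)), sub_eq_add_neg]

/-- Total mass one of the sojourn-time law with bounded hazard rate `g`, truncated at `T`. -/
theorem lintegral_hazard_Ioc {g : ℝ → ℝ≥0∞} (hg : Measurable g) {C : ℝ≥0} (hC : ∀ v, g v ≤ C)
    (T : ℝ) :
    (∫⁻ u in Ioc (0 : ℝ) T, expNeg (∫⁻ v in Ioc 0 u, g v) * g u)
      + expNeg (∫⁻ v in Ioc (0 : ℝ) T, g v) = 1 := by
  have hI : Ioi (0 : ℝ) ∩ Iic T = Ioc 0 T := Ioi_inter_Iic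
  -- The hazard is switched off after T, so that survival forever means survival up to T.
  have h := lintegral_hazard (g := (Iic T).indicator g) (hg.indicator measurableSet_Iic) (C := C)
    fun v => (indicator_le_self _ _ v).trans (hC v)
  rw [← h, setLIntegral_indicator measurableSet_Iic, inter_comm, hI]
  congr 1
  have h1 : ∀ u, expNeg (∫⁻ v in Ioc 0 u, (Iic T).indicator g v) * (Iic T).indicator g u
      = (Iic T).indicator (fun u => expNeg (∫⁻ v in Ioc 0 u, g v) * g u) u := by
    intro u
    by_cases hu : u ∈ Iic T
    · rw [indicator_of_mem hu, indicator_of_mem hu]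
      congr 2
      refine setLIntegral_congr_fun measurableSet_Ioc fun v hv => ?_
      rw [indicator_of_mem (show v ∈ Iic T from hv.2.trans hu)]
    · rw [indicator_of_notMem hu, indicator_of_notMem hu, mul_zero]
  simp_rw [h1]
  rw [setLIntegral_indicator measurableSet_Iic, inter_comm, hI]

variable {S A : Type*}

/-- The history `(θ_0, x_0, …, θ_k, x_k)` of a path. -/
def PathSpace.hist (k : ℕ) (ω : PathSpace S) : Hist S k := fun i => ω.1 i

theorem PathSpace.jumpTime_succ (k : ℕ) (ω : PathSpace S) :
    jumpTime (k + 1) ω = jumpTime k ω + (ω.1 (k + 1)).1 := by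
  simp only [jumpTime]
  rw [Finset.sum_range_succ]

/-- The time `T_k` of the last jump of a history. -/
def Hist.time {k : ℕ} (h : Hist S k) : ℝ≥0∞ := ∑ i, (h i).1

theorem PathSpace.time_hist (k : ℕ) (ω : PathSpace S) :
    (PathSpace.hist k ω).time = jumpTime k ω := by
  have : Finset.range (k + 1) = Finset.Iic k := by
    ext i
    simp
  rw [jumpTime, this, ← Finset.sum_coe_sort]
  rfl

variable [MeasurableSpace S] [MeasurableSpace A]

theorem Hist.measurable_time (k : ℕ) : Measurable (Hist.time : Hist S k → ℝ≥0∞) :=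
  Finset.measurable_sum _ fun i _ => measurable_fst.comp (measurable_pi_apply i)

theorem measurable_startMark : Measurable fun x : S => ((0, Sum.inl x) : Mark S) :=
  measurable_const.prodMk measurable_inl

theorem measurableSet_cemetery : MeasurableSet {m : Mark S | m = cemetery S} := by
  convert (measurableSet_singleton (∞ : ℝ≥0∞)).prod
    (measurableSet_range_inr : MeasurableSet (range Sum.inr : Set (Adjoin S))) using 1
  ext ⟨t, x⟩
  rcases x with x | x <;> simp [cemetery]

namespace Policy

variable [StandardBorelSpace S] {M : Model S A} (π : Policy M)

theorem lintegral_intensity (k : ℕ) (h : Hist S k) (s : ℝ) {f : S → ℝ≥0∞} (hf : Measurable f) :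
    ∫⁻ y, f y ∂(π.intensity k (h, s))
      = ∫⁻ a, ∫⁻ y, f y ∂(M.jumpExt h.last a) ∂(π.histProb k h s) :=
  Measure.lintegral_bind (M.measurable_jumpExt.comp measurable_prodMk_left).aemeasurable
    hf.aemeasurable

theorem lintegral_stepKernel (k : ℕ) (h : Hist S k) {H : Mark S → ℝ≥0∞} (hH : Measurable H) :
    ∫⁻ m, H m ∂(π.stepKernel k h) =
      (∫⁻ s in Ioi (0 : ℝ), expNeg (π.cumIntensity k h s) *
        ∫⁻ y, H (ENNReal.ofReal s, Sum.inl y) ∂(π.intensity k (h, s)))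
      + expNeg (π.totalIntensity k h) * H (cemetery S) := by
  have hmap : Measurable fun p : ℝ × S => ((ENNReal.ofReal p.1, Sum.inl p.2) : Mark S) :=
    (ENNReal.measurable_ofReal.comp measurable_fst).prodMk (measurable_inl.comp measurable_snd)
  have hd : Measurable (Function.uncurry fun (h : Hist S k) (p : ℝ × S) =>
      expNeg (π.cumIntensity k h p.1)) :=
    measurable_expNeg.comp ((π.measurable_cumIntensity k).comp
      (measurable_fst.prodMk (measurable_fst.comp measurable_snd)))
  have hd2 : Measurable (Function.uncurry fun (h : Hist S k) (_ : Mark S) =>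
      expNeg (π.totalIntensity k h)) :=
    measurable_expNeg.comp ((π.measurable_totalIntensity k).comp measurable_fst)
  have hHm : Measurable fun p : ℝ × S => H (ENNReal.ofReal p.1, Sum.inl p.2) := hH.comp hmap
  have hdh : Measurable fun p : ℝ × S => expNeg (π.cumIntensity k h p.1) :=
    hd.comp measurable_prodMk_left
  rw [stepKernel, _root_.add_apply, lintegral_add_measure, Kernel.map_apply _ hmap,
    lintegral_map hH hmap, Kernel.lintegral_withDensity _ hd _ hHm,
    Kernel.lintegral_withDensity _ hd2 _ hH, Kernel.lintegral_compProd _ _ _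
      (f := fun p => expNeg (π.cumIntensity k h p.1) * H (ENNReal.ofReal p.1, Sum.inl p.2))
      (hdh.mul hHm)]
  simp only [Kernel.const_apply]
  rw [lintegral_const_mul _ hH, lintegral_dirac' _ hH]
  congr 1
  refine lintegral_congr fun s => ?_
  rw [lintegral_const_mul]
  exact hHm.comp measurable_prodMk_left

/-- The mass of sojourn times at most s is an integral of hazard times survival, whose complement is
given by the truncated mass identity. The cemetery has sojourn time ∞ and belongs to the tail. -/
theorem stepKernel_tail (k : ℕ) (h : Hist S k) {s : ℝ} (hs : 0 ≤ s) :
    π.stepKernel k h {m | ENNReal.ofReal s < m.1} = expNeg (π.cumIntensity k h s) := by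
  have hm : MeasurableSet {m : Mark S | m.1 ≤ ENNReal.ofReal s} :=
    measurableSet_le measurable_fst measurable_const
  obtain ⟨C, hC⟩ := π.intensity_bounded k h
  have hg : Measurable fun v : ℝ => π.intensity k (h, v) univ :=
    ((π.intensity k).measurable_coe MeasurableSet.univ).comp measurable_prodMk_left
  have h1 : π.stepKernel k h {m | m.1 ≤ ENNReal.ofReal s}
      = ∫⁻ u in Ioc (0 : ℝ) s, expNeg (π.cumIntensity k h u) * π.intensity k (h, u) univ := by
    rw [← lintegral_indicator_one hm, π.lintegral_stepKernel k h
      (measurable_one.indicator hm), ← Ioi_inter_Iic, inter_comm,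
      ← setLIntegral_indicator measurableSet_Iic]
    have h2 : cemetery S ∉ {m : Mark S | m.1 ≤ ENNReal.ofReal s} := by simp [cemetery]
    rw [indicator_of_notMem h2, mul_zero, add_zero]
    refine setLIntegral_congr_fun measurableSet_Ioi fun u hu => ?_
    by_cases hus : u ≤ s
    · rw [indicator_of_mem (show u ∈ Iic s from hus)]
      have : ∀ y : S, ({m : Mark S | m.1 ≤ ENNReal.ofReal s}.indicator 1
          (ENNReal.ofReal u, Sum.inl y) : ℝ≥0∞) = 1 := fun y =>
        indicator_of_mem (show _ ∈ {m : Mark S | m.1 ≤ ENNReal.ofReal s} from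
          ENNReal.ofReal_le_ofReal hus) _
      simp [this]
    · rw [indicator_of_notMem (show u ∉ Iic s from hus)]
      have : ∀ y : S, ({m : Mark S | m.1 ≤ ENNReal.ofReal s}.indicator 1
          (ENNReal.ofReal u, Sum.inl y) : ℝ≥0∞) = 0 := fun y =>
        indicator_of_notMem (s := {m : Mark S | m.1 ≤ ENNReal.ofReal s})
          (fun hy => hus ((ENNReal.ofReal_le_ofReal_iff hs).1 hy)) _
      simp [this]
  have h3 : {m : Mark S | ENNReal.ofReal s < m.1} = {m | m.1 ≤ ENNReal.ofReal s}ᶜ := by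
    ext m
    simp
  have h4 := lintegral_hazard_Ioc hg hC s
  rw [h3, prob_compl_eq_one_sub hm, h1, ← h4]
  refine ENNReal.add_sub_cancel_left ?_
  refine ne_top_of_le_ne_top ENNReal.one_ne_top (h4 ▸ le_self_add)

/-- The expectation of a function of the next jump, written with the jump intensity. -/
theorem lintegral_stepKernel_eq_lintegral_intensity (k : ℕ) (h : Hist S k) {H : Mark S → ℝ≥0∞}
    (hH : Measurable H) (hH0 : H (cemetery S) = 0) :
    ∫⁻ m, H m ∂(π.stepKernel k h) =
      ∫⁻ m, (∫⁻ s in Ioi (0 : ℝ), {s : ℝ | ENNReal.ofReal s < m.1}.indicator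
        (fun s => ∫⁻ y, H (ENNReal.ofReal s, Sum.inl y) ∂(π.intensity k (h, s))) s)
        ∂(π.stepKernel k h) := by
  rw [π.lintegral_stepKernel k h hH, hH0, mul_zero, add_zero]
  set Φ : ℝ → ℝ≥0∞ := fun s => ∫⁻ y, H (ENNReal.ofReal s, Sum.inl y) ∂(π.intensity k (h, s))
    with hΦ
  have hΦm : Measurable Φ := by
    have h1 : Measurable fun p : ℝ × S => H (ENNReal.ofReal p.1, Sum.inl p.2) :=
      hH.comp ((ENNReal.measurable_ofReal.comp measurable_fst).prodMk
        (measurable_inl.comp measurable_snd))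
    exact Measurable.lintegral_kernel_prod_right'
      (κ := (π.intensity k).comap (Prod.mk h) measurable_prodMk_left) h1
  have hset : MeasurableSet {p : Mark S × ℝ | ENNReal.ofReal p.2 < p.1.1} :=
    measurableSet_lt (ENNReal.measurable_ofReal.comp measurable_snd)
      (measurable_fst.comp measurable_fst)
  -- By Fubini the inner integral becomes the probability of surviving beyond s, which is exactly
  -- the exponential factor of the jump density.
  rw [lintegral_lintegral_swap (μ := π.stepKernel k h) (ν := volume.restrict (Ioi (0 : ℝ)))
    (f := fun m s => {s : ℝ | ENNReal.ofReal s < m.1}.indicator Φ s)]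
  · refine setLIntegral_congr_fun measurableSet_Ioi fun s hs => ?_
    have h1 : ∀ m : Mark S, {s : ℝ | ENNReal.ofReal s < m.1}.indicator Φ s
        = {m : Mark S | ENNReal.ofReal s < m.1}.indicator (fun _ => Φ s) m := fun m => rfl
    simp_rw [h1]
    rw [lintegral_indicator_const (measurableSet_lt measurable_const measurable_fst),
      π.stepKernel_tail k h (le_of_lt hs), mul_comm]
  · exact ((hΦm.comp measurable_snd).indicator hset).aemeasurable

theorem intensity_eq_zero (k : ℕ) (h : Hist S k) (hh : h.last = Sum.inr ()) (s : ℝ) :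
    π.intensity k (h, s) = 0 := by
  change (π.histProb k h s).bind (fun a => M.jumpExt h.last a) = 0
  rw [hh]
  have : (fun a => M.jumpExt (Sum.inr ()) a) = fun _ : Adjoin A => (0 : Measure S) := by
    ext1 a
    rfl
  rw [this, Measure.bind_zero_right']

/-- The law of the sequence of sojourn times and states, before it is seen to be concentrated on
the set of paths. -/
def seqLaw (x : S) : Measure (ℕ → Mark S) :=
  Kernel.trajMeasure (X := fun _ => Mark S)
    ((Measure.dirac x).map fun x => ((0, Sum.inl x) : Mark S)) π.stepKernel

instance (x : S) : IsProbabilityMeasure ((Measure.dirac x).map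
    fun x => ((0, Sum.inl x) : Mark S)) :=
  Measure.isProbabilityMeasure_map measurable_startMark.aemeasurable

instance (x : S) : IsProbabilityMeasure (π.seqLaw x) := by
  unfold seqLaw
  infer_instance

/-- The Ionescu-Tulcea property: the joint law of the history and the next mark is the law of the
history composed with `stepKernel`. -/
theorem lintegral_seqLaw_succ (x : S) (k : ℕ) {G : Hist S k × Mark S → ℝ≥0∞} (hG : Measurable G) :
    ∫⁻ ω, G (Preorder.frestrictLe k ω, ω (k + 1)) ∂(π.seqLaw x)
      = ∫⁻ ω, ∫⁻ m, G (Preorder.frestrictLe k ω, m) ∂(π.stepKernel k (Preorder.frestrictLe k ω))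
        ∂(π.seqLaw x) := by
  have h := Kernel.map_frestrictLe_trajMeasure_compProd_eq_map_trajMeasure
    (X := fun _ => Mark S) (κ := π.stepKernel) (a := k)
    (μ₀ := (Measure.dirac x).map fun x => ((0, Sum.inl x) : Mark S))
  have hr : Measurable (Preorder.frestrictLe (π := fun _ => Mark S) k) :=
    Preorder.measurable_frestrictLe k
  have h1 := lintegral_map (μ := π.seqLaw x) hG
    (hr.prodMk (measurable_pi_apply (k + 1)))
  rw [← h1, seqLaw, ← h, Measure.lintegral_compProd hG, lintegral_map _ hr]
  exact hG.lintegral_kernel_prod_right'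

theorem ae_seqLaw_succ (x : S) (k : ℕ) {p : Hist S k × Mark S → Prop}
    (hp : MeasurableSet {z | p z}) (h : ∀ h : Hist S k, ∀ᵐ m ∂(π.stepKernel k h), p (h, m)) :
    ∀ᵐ ω ∂(π.seqLaw x), p (Preorder.frestrictLe k ω, ω (k + 1)) := by
  have h1 := π.lintegral_seqLaw_succ x k (G := {z | p z}ᶜ.indicator 1)
    (measurable_one.indicator hp.compl)
  have h2 : ∀ h : Hist S k, ∫⁻ m, ({z | p z}ᶜ.indicator 1 (h, m) : ℝ≥0∞) ∂(π.stepKernel k h) = 0 :=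
    fun h' => lintegral_eq_zero_of_ae_eq_zero ((h h').mono fun m hm =>
      indicator_of_notMem (fun hc : ¬ p (h', m) => hc hm) _)
  simp only [h2, lintegral_zero] at h1
  have hm : Measurable fun ω : ℕ → Mark S =>
      ({z | p z}ᶜ.indicator 1 (Preorder.frestrictLe k ω, ω (k + 1)) : ℝ≥0∞) :=
    (measurable_one.indicator hp.compl).comp
      ((Preorder.measurable_frestrictLe k).prodMk (measurable_pi_apply (k + 1)))
  rw [lintegral_eq_zero_iff hm] at h1
  filter_upwards [h1] with ω hω
  by_contra hc
  rw [indicator_of_mem (show _ ∈ {z | p z}ᶜ from hc)] at hω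
  simp at hω

theorem ae_seqLaw_zero (x : S) : ∀ᵐ ω ∂(π.seqLaw x), ω 0 = (0, Sum.inl x) := by
  set h₀ : Hist S 0 := (MeasurableEquiv.piUnique fun _ : Finset.Iic 0 => Mark S).symm
    (0, Sum.inl x) with hh₀
  -- A Dirac initial law makes the measure a trajectory measure started at a fixed history, whose
  -- initial marginal is again Dirac.
  have h1 : π.seqLaw x = Kernel.traj (X := fun _ => Mark S) π.stepKernel 0 h₀ := by
    rw [seqLaw, Kernel.trajMeasure, Measure.map_dirac' measurable_startMark,
      Measure.map_dirac' (MeasurableEquiv.measurable _)]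
    exact Measure.dirac_bind (Kernel.measurable _) _
  have h2 : (π.seqLaw x).map (Preorder.frestrictLe (π := fun _ => Mark S) 0)
      = Measure.dirac h₀ := by
    rw [h1, Kernel.traj_map_frestrictLe_apply, Kernel.partialTraj_self, Kernel.id_apply]
  have hm : Measurable fun h : Hist S 0 => h ⟨0, Finset.mem_Iic.2 le_rfl⟩ :=
    measurable_pi_apply _
  have hs : MeasurableSet {m : Mark S | m = (0, Sum.inl x)} := by
    convert (measurableSet_singleton (0 : ℝ≥0∞)).prod
      (MeasurableSet.inl_image (measurableSet_singleton x)) using 1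
    ext ⟨t, y⟩
    simp
  have h3 : ∀ᵐ h ∂((π.seqLaw x).map (Preorder.frestrictLe (π := fun _ => Mark S) 0)),
      h ⟨0, Finset.mem_Iic.2 le_rfl⟩ = ((0, Sum.inl x) : Mark S) := by
    rw [h2]
    refine (ae_dirac_iff (hm hs)).2 ?_
    rfl
  exact ae_of_ae_map (Preorder.measurable_frestrictLe 0).aemeasurable h3

/-- The law on `PathSpace` is a `comap`, which would lose any mass outside the set of paths; this
shows that none is lost. -/
theorem ae_seqLaw_isPath (x : S) : ∀ᵐ ω ∂(π.seqLaw x), IsPath ω := by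
  have hreg : MeasurableSet {m : Mark S | (m.1 ∈ Ioo 0 ∞ ∧ m.2 ∈ range Sum.inl) ∨
      m = cemetery S} :=
    ((measurable_fst measurableSet_Ioo).inter (measurable_snd measurableSet_range_inl)).union
      measurableSet_cemetery
  have hsucc : ∀ n, ∀ᵐ ω ∂(π.seqLaw x), ((ω (n + 1)).1 ∈ Ioo 0 ∞ ∧
      (ω (n + 1)).2 ∈ range Sum.inl) ∨ ω (n + 1) = cemetery S := by
    intro n
    refine π.ae_seqLaw_succ x n (p := fun z => (z.2.1 ∈ Ioo 0 ∞ ∧ z.2.2 ∈ range Sum.inl) ∨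
      z.2 = cemetery S) (measurable_snd hreg) fun h => ?_
    rw [ae_iff]
    change π.stepKernel n h {m | (m.1 ∈ Ioo 0 ∞ ∧ m.2 ∈ range Sum.inl) ∨ m = cemetery S}ᶜ = 0
    rw [← lintegral_indicator_one hreg.compl,
      π.lintegral_stepKernel n h (measurable_one.indicator hreg.compl)]
    rw [indicator_of_notMem (by simp), mul_zero, add_zero, ← nonpos_iff_eq_zero]
    refine (setLIntegral_mono' measurableSet_Ioi fun s hs => ?_).trans_eq
      (lintegral_zero)
    have : ∀ y : S, ({m : Mark S | (m.1 ∈ Ioo 0 ∞ ∧ m.2 ∈ range Sum.inl) ∨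
      m = cemetery S}ᶜ.indicator 1 (ENNReal.ofReal s, Sum.inl y) : ℝ≥0∞) = 0 := fun y =>
        indicator_of_notMem (by simpa using fun hc => absurd hs (not_lt.2 hc)) _
    simp only [this, lintegral_zero, mul_zero, le_refl]
  have habs : ∀ n, ∀ᵐ ω ∂(π.seqLaw x), ω n = cemetery S → ω (n + 1) = cemetery S := by
    intro n
    have hm : MeasurableSet {z : Hist S n × Mark S |
        z.1 ⟨n, Finset.mem_Iic.2 le_rfl⟩ = cemetery S → z.2 = cemetery S} := by
      have h1 : MeasurableSet {z : Hist S n × Mark S |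
          z.1 ⟨n, Finset.mem_Iic.2 le_rfl⟩ = cemetery S} :=
        ((measurable_pi_apply (X := fun _ : Finset.Iic n => Mark S)
          ⟨n, Finset.mem_Iic.2 le_rfl⟩).comp measurable_fst) measurableSet_cemetery
      have h2 : MeasurableSet {z : Hist S n × Mark S | z.2 = cemetery S} :=
        measurable_snd measurableSet_cemetery
      exact h1.imp h2
    refine π.ae_seqLaw_succ x n (p := fun z =>
      z.1 ⟨n, Finset.mem_Iic.2 le_rfl⟩ = cemetery S → z.2 = cemetery S) hm fun h => ?_
    by_cases hc : h ⟨n, Finset.mem_Iic.2 le_rfl⟩ = cemetery S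
    -- From x_∞ the intensity vanishes, so the step law is the point mass at the cemetery.
    · have hl : h.last = Sum.inr () := by rw [Hist.last, hc]; rfl
      have h3 : ∀ᵐ m ∂(π.stepKernel n h), m = cemetery S := by
        rw [ae_iff]
        change π.stepKernel n h {m | m = cemetery S}ᶜ = 0
        rw [← lintegral_indicator_one measurableSet_cemetery.compl,
          π.lintegral_stepKernel n h (measurable_one.indicator measurableSet_cemetery.compl)]
        simp [π.intensity_eq_zero n h hl]
      filter_upwards [h3] with m hm _ using hm
    · exact Eventually.of_forall fun m hm => absurd hm hc
  filter_upwards [π.ae_seqLaw_zero x, ae_all_iff.2 hsucc, ae_all_iff.2 habs] with ω h0 h1 h2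
  exact ⟨by simp [h0], h1, h2⟩

theorem map_lawFrom (x : S) : (π.lawFrom x).map Subtype.val = π.seqLaw x := by
  have he : MeasurableEmbedding (Subtype.val : PathSpace S → ℕ → Mark S) :=
    MeasurableEmbedding.subtype_coe measurableSet_isPath
  change ((π.seqLaw x).comap Subtype.val).map Subtype.val = _
  rw [he.map_comap, Subtype.range_coe_subtype]
  exact Measure.restrict_eq_self_of_ae_mem (π.ae_seqLaw_isPath x)

instance (x : S) : IsProbabilityMeasure (π.lawFrom x) := by
  refine ⟨?_⟩
  rw [← preimage_univ (f := (Subtype.val : PathSpace S → ℕ → Mark S)),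
    ← Measure.map_apply measurable_subtype_coe MeasurableSet.univ, π.map_lawFrom, measure_univ]

theorem ae_state_zero (x : S) : ∀ᵐ ω ∂(π.lawFrom x), PathSpace.state 0 ω = Sum.inl x := by
  have h := π.ae_seqLaw_zero x
  rw [← π.map_lawFrom] at h
  filter_upwards [ae_of_ae_map measurable_subtype_coe.aemeasurable h] with ω hω
  rw [PathSpace.state, hω]

/-- The conditional law of the next sojourn time and state given the history. -/
theorem lintegral_lawFrom_succ (x : S) (k : ℕ) {G : Hist S k × Mark S → ℝ≥0∞} (hG : Measurable G) :
    ∫⁻ ω, G (PathSpace.hist k ω, ω.1 (k + 1)) ∂(π.lawFrom x)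
      = ∫⁻ ω, ∫⁻ m, G (PathSpace.hist k ω, m) ∂(π.stepKernel k (PathSpace.hist k ω))
        ∂(π.lawFrom x) := by
  have h := π.lintegral_seqLaw_succ x k hG
  have hr : Measurable (Preorder.frestrictLe (π := fun _ => Mark S) k) :=
    Preorder.measurable_frestrictLe k
  rw [← π.map_lawFrom, lintegral_map
    (f := fun ω : ℕ → Mark S => G (Preorder.frestrictLe k ω, ω (k + 1)))
    (hG.comp (hr.prodMk (measurable_pi_apply (k + 1)))) measurable_subtype_coe,
    lintegral_map (f := fun ω : ℕ → Mark S => ∫⁻ m, G (Preorder.frestrictLe k ω, m)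
      ∂(π.stepKernel k (Preorder.frestrictLe k ω)))
      (hG.lintegral_kernel_prod_right'.comp hr) measurable_subtype_coe] at h
  exact h

end Policy

end

/-! ### Paths: telescoping, measurability, and the consequences of predictability. -/

section

variable {S A : Type*}

namespace PathSpace

theorem jumpTime_mono (ω : PathSpace S) : Monotone fun k => jumpTime k ω :=
  monotone_nat_of_le_succ fun k => by
    rw [jumpTime_succ]
    exact le_self_add

theorem jumpTime_zero (ω : PathSpace S) : jumpTime 0 ω = 0 := by
  simp [jumpTime, ω.2.zero.1]

theorem state_mem_range_inl {ω : PathSpace S} {k : ℕ} (h : jumpTime k ω ≠ ∞) :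
    state k ω ∈ range Sum.inl := by
  rcases k with - | k
  · exact ω.2.zero.2
  · rcases ω.2.succ k with h1 | h1
    · exact h1.2
    · rw [jumpTime_succ, h1] at h
      simp [cemetery] at h

theorem eq_of_mem_Ico {ω : PathSpace S} {t : ℝ≥0∞} {m n : ℕ} (hm : jumpTime m ω ≤ t)
    (hm' : t < jumpTime (m + 1) ω) (hn : jumpTime n ω ≤ t) (hn' : t < jumpTime (n + 1) ω) :
    m = n := by
  by_contra hne
  rcases Nat.lt_or_gt_of_ne hne with h | h
  · exact absurd (hm'.trans_le (jumpTime_mono ω h)) (not_lt.2 hn)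
  · exact absurd (hn'.trans_le (jumpTime_mono ω h)) (not_lt.2 hm)

theorem process_eq_state {ω : PathSpace S} {t : ℝ≥0} {m : ℕ} (h : jumpTime m ω ≤ t)
    (h' : t < jumpTime (m + 1) ω) : process t ω = state m ω := by
  classical
  have hex : ∃ m, jumpTime m ω ≤ t ∧ t < jumpTime (m + 1) ω := ⟨m, h, h'⟩
  rw [process, dif_pos hex]
  congr 1
  exact eq_of_mem_Ico (Nat.find_spec hex).1 (Nat.find_spec hex).2 h h'

theorem process_eq_inr {ω : PathSpace S} {t : ℝ≥0}
    (h : ¬ ∃ m, jumpTime m ω ≤ t ∧ t < jumpTime (m + 1) ω) : process t ω = Sum.inr () := by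
  rw [process, dif_neg h]

theorem jumpTime_le_of_not_exists {ω : PathSpace S} {t : ℝ≥0}
    (h : ¬ ∃ m, jumpTime m ω ≤ t ∧ t < jumpTime (m + 1) ω) (m : ℕ) : jumpTime m ω ≤ t := by
  induction m with
  | zero => simp [jumpTime_zero]
  | succ m ih =>
    by_contra hc
    exact h ⟨m, ih, not_le.1 hc⟩

/-- Telescoping over the jumps up to time `t`. -/
theorem telescope {ω : PathSpace S} {t : ℝ≥0}
    (h : ∃ m, jumpTime m ω ≤ t ∧ t < jumpTime (m + 1) ω) (f : Adjoin S → ℝ≥0∞) :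
    f (process t ω) + ∑' k, {ω | jumpTime (k + 1) ω ≤ t}.indicator (fun ω => f (state k ω)) ω
      = f (state 0 ω) +
        ∑' k, {ω | jumpTime (k + 1) ω ≤ t}.indicator (fun ω => f (state (k + 1) ω)) ω := by
  obtain ⟨m, h1, h2⟩ := h
  -- Exactly the first m jumps occur by time t, so both series are finite sums over the same range,
  -- shifted by one.
  have h3 : ∀ k, ω ∈ {ω : PathSpace S | jumpTime (k + 1) ω ≤ t} ↔ k ∈ Finset.range m := by
    intro k
    rw [Finset.mem_range]
    refine ⟨fun hk => ?_, fun hk => (jumpTime_mono ω hk).trans h1⟩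
    by_contra hc
    exact absurd (h2.trans_le (jumpTime_mono ω (Nat.succ_le_succ (not_lt.1 hc)))) (not_lt.2 hk)
  have h4 : ∀ g : ℕ → PathSpace S → ℝ≥0∞,
      ∑' k, {ω | jumpTime (k + 1) ω ≤ t}.indicator (fun ω => g k ω) ω
        = ∑ k ∈ Finset.range m, g k ω := by
    intro g
    rw [tsum_eq_sum (s := Finset.range m)]
    · exact Finset.sum_congr rfl fun k hk => indicator_of_mem ((h3 k).2 hk) _
    · exact fun k hk => indicator_of_notMem (fun hc => hk ((h3 k).1 hc)) _
  rw [h4 fun k ω => f (state k ω), h4 fun k ω => f (state (k + 1) ω), process_eq_state h1 h2,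
    add_comm, ← Finset.sum_range_succ fun k => f (state k ω), Finset.sum_range_succ', add_comm]

theorem isPath_extend_hist (k : ℕ) (ω : PathSpace S) : IsPath (hist k ω).extend := by
  have h1 : ∀ n ≤ k, (hist k ω).extend n = ω.1 n := fun n hn => by
    simp [Hist.extend, hist, hn]
  have h2 : ∀ n, ¬ n ≤ k → (hist k ω).extend n = cemetery S := fun n hn => by
    simp [Hist.extend, hn]
  refine ⟨?_, fun n => ?_, fun n hn => ?_⟩
  · rw [h1 0 (Nat.zero_le k)]
    exact ω.2.zero
  · by_cases h : n + 1 ≤ k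
    · rw [h1 _ h]
      exact ω.2.succ n
    · exact Or.inr (h2 _ h)
  · by_cases h : n + 1 ≤ k
    · rw [h1 _ h]
      rw [h1 _ (Nat.le_of_succ_le h)] at hn
      exact ω.2.absorb n hn
    · exact h2 _ h

/-- The path that has the same history up to the `k`-th jump as `ω`, and no further jumps. -/
def stopped (k : ℕ) (ω : PathSpace S) : PathSpace S := ⟨(hist k ω).extend, isPath_extend_hist k ω⟩

theorem stopped_apply {k i : ℕ} (ω : PathSpace S) (hi : i ≤ k) : (stopped k ω).1 i = ω.1 i := by
  simp [stopped, Hist.extend, hist, hi]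

theorem jumpTime_stopped (k : ℕ) (ω : PathSpace S) : jumpTime k (stopped k ω) = jumpTime k ω :=
  Finset.sum_congr rfl fun i hi => by
    rw [stopped_apply ω (Nat.lt_succ_iff.1 (Finset.mem_range.1 hi))]

theorem jumpTime_succ_stopped (k : ℕ) (ω : PathSpace S) : jumpTime (k + 1) (stopped k ω) = ∞ := by
  rw [jumpTime_succ]
  simp [stopped, Hist.extend, cemetery]

variable [MeasurableSpace S]

theorem measurable_process : Measurable fun p : ℝ≥0 × PathSpace S => process p.1 p.2 := by
  have hE : ∀ m, MeasurableSet {p : ℝ≥0 × PathSpace S | jumpTime m p.2 ≤ p.1 ∧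
      p.1 < jumpTime (m + 1) p.2} := fun m =>
    (measurableSet_le ((measurable_jumpTime m).comp measurable_snd)
      measurable_fst.coe_nnreal_ennreal).inter
    (measurableSet_lt measurable_fst.coe_nnreal_ennreal
      ((measurable_jumpTime (m + 1)).comp measurable_snd))
  intro B hB
  have : (fun p : ℝ≥0 × PathSpace S => process p.1 p.2) ⁻¹' B =
      (⋃ m, {p : ℝ≥0 × PathSpace S | jumpTime m p.2 ≤ p.1 ∧ p.1 < jumpTime (m + 1) p.2} ∩
        {p | state m p.2 ∈ B}) ∪
      ((⋃ m, {p : ℝ≥0 × PathSpace S | jumpTime m p.2 ≤ p.1 ∧ p.1 < jumpTime (m + 1) p.2})ᶜ ∩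
        {_p | Sum.inr () ∈ B}) := by
    ext p
    by_cases h : ∃ m, jumpTime m p.2 ≤ p.1 ∧ p.1 < jumpTime (m + 1) p.2
    · obtain ⟨m, hm⟩ := h
      simp only [mem_preimage, process_eq_state hm.1 hm.2, mem_union, mem_iUnion, mem_inter_iff,
        mem_compl_iff]
      refine ⟨fun hB => Or.inl ⟨m, hm, hB⟩, ?_⟩
      rintro (⟨n, hn, hB⟩ | hc)
      · rwa [eq_of_mem_Ico hm.1 hm.2 hn.1 hn.2]
      · exact absurd ⟨m, hm⟩ hc.1
    · simp only [mem_preimage, process_eq_inr h, mem_union, mem_iUnion, mem_inter_iff,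
        mem_compl_iff]
      refine ⟨fun hB => Or.inr ⟨h, hB⟩, ?_⟩
      rintro (⟨n, hn, hB⟩ | hc)
      · exact absurd ⟨n, hn⟩ h
      · exact hc.2
  rw [this]
  exact (MeasurableSet.iUnion fun m => (hE m).inter
    (((measurable_state m).comp measurable_snd) hB)).union
    ((MeasurableSet.iUnion hE).compl.inter (MeasurableSet.const _))

/-- Events in `F_s` do not distinguish paths that agree up to the `k`-th jump and have no further
jumps up to time `s`. -/
theorem mem_iff_mem_of_filtration {ω ω' : PathSpace S} {k : ℕ} {s : ℝ≥0}
    (h : ∀ i ≤ k, ω.1 i = ω'.1 i) (hs : s < jumpTime (k + 1) ω) (hs' : s < jumpTime (k + 1) ω')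
    {B : Set (PathSpace S)} (hB : MeasurableSet[filtration S s] B) : ω ∈ B ↔ ω' ∈ B := by
  induction B, hB using MeasurableSpace.generateFrom_induction with
  | hC t ht _ =>
    obtain ⟨m, r, Γ, hr, -, rfl⟩ := ht
    have hr' : (r : ℝ≥0∞) ≤ s := by exact_mod_cast hr
    by_cases hm : m ≤ k
    · have h1 : jumpTime m ω = jumpTime m ω' := Finset.sum_congr rfl fun i hi => by
        rw [h i ((Nat.lt_succ_iff.1 (Finset.mem_range.1 hi)).trans hm)]
      have h2 : state m ω = state m ω' := by rw [state, state, h m hm]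
      simp only [mem_ofPred_eq, h1, h2]
    · have hm' : k + 1 ≤ m := Nat.lt_of_not_le hm
      have h1 : ¬ jumpTime m ω ≤ r :=
        not_le.2 (hr'.trans_lt (hs.trans_le (jumpTime_mono ω hm')))
      have h2 : ¬ jumpTime m ω' ≤ r :=
        not_le.2 (hr'.trans_lt (hs'.trans_le (jumpTime_mono ω' hm')))
      simp only [mem_ofPred_eq, h1, h2, false_and]
  | empty => simp
  | compl t _ ih => simpa using not_congr ih
  | iUnion f _ ih => simp [ih]

/-- Predictable sets do not distinguish paths that agree up to the `k`-th jump and have no further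
jumps before time `v`. -/
theorem mem_iff_mem_of_predictable {ω ω' : PathSpace S} {k : ℕ} {v : ℝ≥0} (hv : 0 < v)
    (h : ∀ i ≤ k, ω.1 i = ω'.1 i) (hs : v ≤ jumpTime (k + 1) ω) (hs' : v ≤ jumpTime (k + 1) ω')
    {E : Set (ℝ≥0 × PathSpace S)} (hE : MeasurableSet[(filtration S).predictable] E) :
    (v, ω) ∈ E ↔ (v, ω') ∈ E := by
  induction E, hE using MeasurableSpace.generateFrom_induction with
  | hC t ht _ =>
    -- Generators at time 0 are excluded by v > 0. For (s, ∞) × B with B in F_s, only s < v matters;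
    -- this strict inequality is why v ≤ T_{k+1} suffices.
    rcases ht with ⟨B, -, rfl⟩ | ⟨s, B, hB, rfl⟩
    · simp [hv.ne']
    · by_cases hsv : s < v
      · have hsv' : (s : ℝ≥0∞) < v := by exact_mod_cast hsv
        simpa [hsv] using mem_iff_mem_of_filtration h (hsv'.trans_le hs) (hsv'.trans_le hs') hB
      · simp [hsv]
  | empty => simp
  | compl t _ ih => simpa using not_congr ih
  | iUnion f _ ih => simp [ih]

end PathSpace

namespace Policy

variable [MeasurableSpace S] [MeasurableSpace A] {M : Model S A} (π : Policy M)

/-- The level set of π(B | ·, ·) at its value in (v, ω') is a predictable set, so it cannot contain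
(v, ω') without containing (v, ω). -/
theorem prob_congr {ω ω' : PathSpace S} {k : ℕ} {v : ℝ≥0} (hv : 0 < v)
    (h : ∀ i ≤ k, ω.1 i = ω'.1 i) (hs : v ≤ PathSpace.jumpTime (k + 1) ω)
    (hs' : v ≤ PathSpace.jumpTime (k + 1) ω') : π.prob v ω = π.prob v ω' := by
  ext B hB
  have := PathSpace.mem_iff_mem_of_predictable hv h hs hs'
    (π.predictable B hB (measurableSet_singleton (π.prob v ω' B)))
  exact this.2 rfl

/-- `histProb` evaluates π on the path stopped after k jumps. That path and ω share the history and
have no further jump before the time in question, so predictability identifies the two values. -/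
theorem histProb_hist (k : ℕ) (ω : PathSpace S) {s : ℝ} (hs : 0 < s)
    (hT : PathSpace.jumpTime k ω ≠ ∞)
    (h : PathSpace.jumpTime k ω + ENNReal.ofReal s ≤ PathSpace.jumpTime (k + 1) ω) :
    π.histProb k (PathSpace.hist k ω) s
      = π.prob ((PathSpace.jumpTime k ω).toNNReal + s.toNNReal) ω := by
  have h1 : ((PathSpace.jumpTime k ω).toNNReal + s.toNNReal : ℝ≥0)
      ≤ PathSpace.jumpTime (k + 1) ω := by
    rw [ENNReal.coe_add, ENNReal.coe_toNNReal hT]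
    exact h
  rw [histProb, dif_pos (PathSpace.isPath_extend_hist k ω)]
  change π.prob ((PathSpace.jumpTime k (PathSpace.stopped k ω)).toNNReal + s.toNNReal)
    (PathSpace.stopped k ω) = _
  rw [PathSpace.jumpTime_stopped]
  refine π.prob_congr (k := k) ?_ (fun i hi => PathSpace.stopped_apply ω hi) ?_ h1
  · exact add_pos_of_nonneg_of_pos zero_le (Real.toNNReal_pos.2 hs)
  · rw [PathSpace.jumpTime_succ_stopped]
    exact le_top

/-- The policy as a kernel. -/
def probKernel : Kernel (ℝ≥0 × PathSpace S) (Adjoin A) where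
  toFun p := π.prob p.1 p.2
  measurable' := π.measurable_prob

instance : IsMarkovKernel π.probKernel := ⟨fun p => π.isProbabilityMeasure p.1 p.2⟩

variable [StandardBorelSpace S]

/-- The intensity `∫_A π(da | ω, v) ∫_S q(dy \ {ξ_v} | ξ_v, a) G(ξ_v, y)` at time `v` of the
jumps, weighted with a function of the states before and after the jump. -/
def jumpRate (G : Adjoin S × Adjoin S → ℝ≥0∞) (v : ℝ≥0) (ω : PathSpace S) : ℝ≥0∞ :=
  ∫⁻ a, ∫⁻ y, G (PathSpace.process v ω, Sum.inl y) ∂(M.jumpExt (PathSpace.process v ω) a)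
    ∂(π.prob v ω)

theorem measurable_jumpRate {G : Adjoin S × Adjoin S → ℝ≥0∞} (hG : Measurable G) :
    Measurable fun p : ℝ≥0 × PathSpace S => π.jumpRate G p.1 p.2 := by
  exact Measurable.lintegral_kernel_prod_right' (κ := π.probKernel)
    (f := fun z => ∫⁻ y, G (PathSpace.process z.1.1 z.1.2, Sum.inl y)
      ∂(M.jumpExt (PathSpace.process z.1.1 z.1.2) z.2))
    ((M.measurable_lintegral_jumpExt hG).comp
      ((PathSpace.measurable_process.comp measurable_fst).prodMk measurable_snd))

end Policy

end

/-! ### Compensators of the jumps. -/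

section

variable {S A : Type*} [MeasurableSpace S] [MeasurableSpace A]

namespace Policy

variable [StandardBorelSpace S] {M : Model S A} (π : Policy M)

/-- Between T_k and T_{k+1} the process sits at x_k and π depends on the history alone. This turns
intensities indexed by k and elapsed time into a single rate indexed by absolute time. -/
theorem jumpRate_eq_lintegral_intensity {G : Adjoin S × Adjoin S → ℝ≥0∞} (hG : Measurable G)
    {k : ℕ} {ω : PathSpace S} {v : ℝ} (hT : PathSpace.jumpTime k ω ≠ ∞)
    (h1 : (PathSpace.jumpTime k ω).toReal < v)
    (h2 : ENNReal.ofReal v < PathSpace.jumpTime (k + 1) ω) :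
    ∫⁻ y, G (PathSpace.state k ω, Sum.inl y)
        ∂(π.intensity k (PathSpace.hist k ω, v - (PathSpace.jumpTime k ω).toReal))
      = π.jumpRate G v.toNNReal ω := by
  set τ := (PathSpace.jumpTime k ω).toReal with hτ
  have hτ0 : 0 ≤ τ := ENNReal.toReal_nonneg
  have hτT : PathSpace.jumpTime k ω = ENNReal.ofReal τ := (ENNReal.ofReal_toReal hT).symm
  have hv : (PathSpace.jumpTime k ω).toNNReal + (v - τ).toNNReal = v.toNNReal := by
    have : (PathSpace.jumpTime k ω).toNNReal = τ.toNNReal := by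
      rw [hτT]; rfl
    rw [this, ← Real.toNNReal_add hτ0 (sub_nonneg.2 h1.le), add_sub_cancel]
  have hadd : PathSpace.jumpTime k ω + ENNReal.ofReal (v - τ) = ENNReal.ofReal v := by
    rw [hτT, ← ENNReal.ofReal_add hτ0 (sub_nonneg.2 h1.le), add_sub_cancel]
  have hp : PathSpace.process v.toNNReal ω = PathSpace.state k ω := by
    refine PathSpace.process_eq_state ?_ h2
    rw [hτT]
    exact ENNReal.ofReal_le_ofReal h1.le
  rw [π.lintegral_intensity k _ _ (f := fun y => G (PathSpace.state k ω, Sum.inl y))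
      (hG.comp (measurable_const.prodMk measurable_inl)),
    π.histProb_hist k ω (sub_pos.2 h1) hT (by rw [hadd]; exact h2.le), hv, jumpRate, hp]
  rfl

/-- The compensator of the `(k+1)`-st jump. -/
theorem lintegral_jump (x : S) (k : ℕ) {G : Adjoin S × Adjoin S → ℝ≥0∞} (hG : Measurable G)
    (t : ℝ≥0) :
    ∫⁻ ω, {ω | PathSpace.jumpTime (k + 1) ω ≤ t}.indicator
        (fun ω => G (PathSpace.state k ω, PathSpace.state (k + 1) ω)) ω ∂(π.lawFrom x)
      = ∫⁻ ω, (∫⁻ v in Ioc (0 : ℝ) t,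
        {v : ℝ | PathSpace.jumpTime k ω < ENNReal.ofReal v ∧
          ENNReal.ofReal v < PathSpace.jumpTime (k + 1) ω}.indicator
        (fun v => π.jumpRate G v.toNNReal ω) v) ∂(π.lawFrom x) := by
  set H : Hist S k × Mark S → ℝ≥0∞ := {z | z.1.time + z.2.1 ≤ (t : ℝ≥0∞)}.indicator
    (fun z => G (z.1.last, z.2.2)) with hHdef
  have hset : MeasurableSet {z : Hist S k × Mark S | z.1.time + z.2.1 ≤ t} :=
    measurableSet_le (((Hist.measurable_time k).comp measurable_fst).add
      (measurable_fst.comp measurable_snd)) measurable_const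
  have hH : Measurable H := Measurable.indicator
    (hG.comp (((Hist.measurable_last k).comp measurable_fst).prodMk
      (measurable_snd.comp measurable_snd))) hset
  have hH0 : ∀ h, H (h, cemetery S) = 0 := fun h =>
    indicator_of_notMem (by simp [cemetery]) _
  have hL : ∀ ω : PathSpace S, {ω | PathSpace.jumpTime (k + 1) ω ≤ t}.indicator
      (fun ω => G (PathSpace.state k ω, PathSpace.state (k + 1) ω)) ω
      = H (PathSpace.hist k ω, ω.1 (k + 1)) := by
    intro ω
    simp only [hHdef, indicator, mem_ofPred_eq, PathSpace.time_hist, PathSpace.jumpTime_succ]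
    rfl
  set Φ : Hist S k × ℝ → ℝ≥0∞ := fun p =>
    ∫⁻ y, H (p.1, (ENNReal.ofReal p.2, Sum.inl y)) ∂(π.intensity k p) with hΦdef
  have hΦ : Measurable Φ :=
    Measurable.lintegral_kernel_prod_right' (κ := π.intensity k)
      (f := fun z => H (z.1.1, (ENNReal.ofReal z.1.2, Sum.inl z.2)))
      (hH.comp ((measurable_fst.comp measurable_fst).prodMk
        ((ENNReal.measurable_ofReal.comp (measurable_snd.comp measurable_fst)).prodMk
          (measurable_inl.comp measurable_snd))))
  set Ψ : Hist S k × Mark S → ℝ≥0∞ := fun z =>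
    ∫⁻ s in Ioi (0 : ℝ), {s : ℝ | ENNReal.ofReal s < z.2.1}.indicator (fun s => Φ (z.1, s)) s
    with hΨdef
  have hΨ : Measurable Ψ := by
    have hs : MeasurableSet {p : (Hist S k × Mark S) × ℝ | ENNReal.ofReal p.2 < p.1.2.1} :=
      measurableSet_lt (ENNReal.measurable_ofReal.comp measurable_snd)
        (measurable_fst.comp (measurable_snd.comp measurable_fst))
    exact Measurable.lintegral_prod_right' (f := fun p : (Hist S k × Mark S) × ℝ =>
      {p : (Hist S k × Mark S) × ℝ | ENNReal.ofReal p.2 < p.1.2.1}.indicator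
        (fun p => Φ (p.1.1, p.2)) p)
      ((hΦ.comp ((measurable_fst.comp measurable_fst).prodMk measurable_snd)).indicator hs)
  simp_rw [hL]
  -- Conditioning on the history lets the jump be traded for its intensity integrated over the
  -- sojourn.
  rw [π.lintegral_lawFrom_succ x k hH]
  simp_rw [fun h => π.lintegral_stepKernel_eq_lintegral_intensity k h
    (H := fun m => H (h, m)) (hH.comp measurable_prodMk_left) (hH0 h)]
  change ∫⁻ ω, ∫⁻ m, Ψ (PathSpace.hist k ω, m) ∂(π.stepKernel k (PathSpace.hist k ω))
    ∂(π.lawFrom x) = _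
  -- The conditioning is undone, and what remains is an identity on each single path.
  rw [← π.lintegral_lawFrom_succ x k hΨ]
  refine lintegral_congr fun ω => ?_
  by_cases hT : PathSpace.jumpTime k ω = ∞
  · have h1 : ∀ s, Φ (PathSpace.hist k ω, s) = 0 := fun s => by
      simp only [hΦdef]
      refine lintegral_eq_zero_of_ae_eq_zero (Eventually.of_forall fun y => ?_)
      refine indicator_of_notMem ?_ _
      simp [PathSpace.time_hist, hT]
    simp [hΨdef, h1, hT]
  set τ := (PathSpace.jumpTime k ω).toReal with hτ
  have hτ0 : 0 ≤ τ := ENNReal.toReal_nonneg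
  have hτT : PathSpace.jumpTime k ω = ENNReal.ofReal τ := (ENNReal.ofReal_toReal hT).symm
  simp only [hΨdef]
  -- The translation by τ = T_k passes from elapsed time in the sojourn to absolute time.
  rw [← lintegral_indicator measurableSet_Ioi, ← lintegral_indicator measurableSet_Ioc,
    ← lintegral_sub_right_eq_self _ τ]
  refine lintegral_congr fun v => ?_
  simp only [indicator, mem_Ioi, mem_ofPred_eq, mem_Ioc, sub_pos]
  by_cases hv : τ < v
  · have hv0 : 0 < v := hτ0.trans_lt hv
    have hadd : PathSpace.jumpTime k ω + ENNReal.ofReal (v - τ) = ENNReal.ofReal v := by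
      rw [hτT, ← ENNReal.ofReal_add hτ0 (sub_nonneg.2 hv.le), add_sub_cancel]
    have h1 : ENNReal.ofReal (v - τ) < (ω.1 (k + 1)).1 ↔
        ENNReal.ofReal v < PathSpace.jumpTime (k + 1) ω := by
      rw [← hadd, PathSpace.jumpTime_succ, ENNReal.add_lt_add_iff_left hT]
    have h2 : PathSpace.jumpTime k ω < ENNReal.ofReal v := by
      rw [hτT]
      exact (ENNReal.ofReal_lt_ofReal_iff hv0).2 hv
    have h3 : Φ (PathSpace.hist k ω, v - τ) = if v ≤ t then ∫⁻ y, G (PathSpace.state k ω, Sum.inl y)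
        ∂(π.intensity k (PathSpace.hist k ω, v - τ)) else 0 := by
      simp only [hΦdef, hHdef, indicator, mem_ofPred_eq, PathSpace.time_hist, hadd]
      have h4 : ENNReal.ofReal v ≤ t ↔ v ≤ t := ENNReal.ofReal_le_coe
      simp only [h4]
      split_ifs
      · rfl
      · simp
    simp only [hv, if_true, h1, h2, true_and, hv0, h3]
    split_ifs with ha hb
    · exact π.jumpRate_eq_lintegral_intensity hG hT hv ha
    all_goals rfl
  · have h2 : ¬ PathSpace.jumpTime k ω < ENNReal.ofReal v := by
      rw [hτT, not_lt]
      exact ENNReal.ofReal_le_ofReal (not_lt.1 hv)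
    simp [hv, h2]

/-- The expected sum over the jumps up to time `t` is the expected integral of their intensity. -/
theorem lintegral_tsum_jump (x : S) {G : Adjoin S × Adjoin S → ℝ≥0∞} (hG : Measurable G)
    (t : ℝ≥0) :
    ∫⁻ ω, ∑' k, {ω | PathSpace.jumpTime (k + 1) ω ≤ t}.indicator
        (fun ω => G (PathSpace.state k ω, PathSpace.state (k + 1) ω)) ω ∂(π.lawFrom x)
      = ∫⁻ ω, (∫⁻ v in Ioc (0 : ℝ) t, π.jumpRate G v.toNNReal ω) ∂(π.lawFrom x) := by
  have hrate : Measurable fun p : PathSpace S × ℝ => π.jumpRate G p.2.toNNReal p.1 :=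
    (π.measurable_jumpRate hG).comp (measurable_snd.real_toNNReal.prodMk measurable_fst)
  have hset : ∀ k, MeasurableSet {p : PathSpace S × ℝ |
      PathSpace.jumpTime k p.1 < ENNReal.ofReal p.2 ∧
      ENNReal.ofReal p.2 < PathSpace.jumpTime (k + 1) p.1} := fun k =>
    (measurableSet_lt ((PathSpace.measurable_jumpTime k).comp measurable_fst)
      (ENNReal.measurable_ofReal.comp measurable_snd)).inter
    (measurableSet_lt (ENNReal.measurable_ofReal.comp measurable_snd)
      ((PathSpace.measurable_jumpTime (k + 1)).comp measurable_fst))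
  have hF : ∀ k, Measurable fun p : PathSpace S × ℝ =>
      {v : ℝ | PathSpace.jumpTime k p.1 < ENNReal.ofReal v ∧
        ENNReal.ofReal v < PathSpace.jumpTime (k + 1) p.1}.indicator
        (fun v => π.jumpRate G v.toNNReal p.1) p.2 := fun k => hrate.indicator (hset k)
  rw [lintegral_tsum]
  · simp_rw [fun k => π.lintegral_jump x k hG t]
    rw [← lintegral_tsum fun k => (Measurable.lintegral_prod_right' (hF k)).aemeasurable]
    refine lintegral_congr fun ω => ?_
    have hFω : ∀ k, Measurable fun v : ℝ => {v : ℝ | PathSpace.jumpTime k ω < ENNReal.ofReal v ∧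
        ENNReal.ofReal v < PathSpace.jumpTime (k + 1) ω}.indicator
        (fun v => π.jumpRate G v.toNNReal ω) v := fun k => (hF k).comp measurable_prodMk_left
    dsimp only
    rw [← lintegral_tsum fun k => (hFω k).aemeasurable]
    refine lintegral_congr_ae ?_
    rw [EventuallyEq, ae_restrict_iff' measurableSet_Ioc]
    -- The open windows (T_k, T_{k+1}) miss the jump times themselves, a countable and hence null
    -- set.
    have hc : (range fun k => (PathSpace.jumpTime k ω).toReal).Countable := countable_range _
    filter_upwards [hc.ae_notMem volume] with v hv hv0
    by_cases h : ∃ m, PathSpace.jumpTime m ω ≤ v.toNNReal ∧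
        v.toNNReal < PathSpace.jumpTime (m + 1) ω
    · obtain ⟨m, h1, h2⟩ := h
      rw [tsum_eq_single m]
      · have hm : v ∈ {v : ℝ | PathSpace.jumpTime m ω < ENNReal.ofReal v ∧
            ENNReal.ofReal v < PathSpace.jumpTime (m + 1) ω} := by
          refine ⟨lt_of_le_of_ne h1 fun hc => hv ⟨m, ?_⟩, h2⟩
          simp only [hc]
          exact ENNReal.toReal_ofReal hv0.1.le
        exact indicator_of_mem hm _
      · refine fun n hn => indicator_of_notMem (fun hc => hn ?_) _
        exact PathSpace.eq_of_mem_Ico hc.1.le hc.2 h1 h2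
    -- After an explosion the process is at x_∞, where the rate is zero; non-explosion is therefore
    -- not needed here.
    · have h1 : π.jumpRate G v.toNNReal ω = 0 := by
        rw [jumpRate, PathSpace.process_eq_inr h]
        simp [Model.jumpExt]
      rw [h1]
      refine ENNReal.tsum_eq_zero.2 fun k => indicator_of_notMem (fun hc => h ⟨k, hc.1.le, hc.2⟩) _
  · exact fun k => ((hG.comp ((PathSpace.measurable_state k).prodMk
      (PathSpace.measurable_state (k + 1)))).indicator (measurableSet_le
        (PathSpace.measurable_jumpTime (k + 1)) measurable_const)).aemeasurable

end Policy

end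

/-! ### Exponential growth bounds for a weight. -/

section

variable {S A : Type*} [MeasurableSpace S] [MeasurableSpace A]

namespace Policy

variable [StandardBorelSpace S] {M : Model S A} (π : Policy M)

theorem lintegral_intensity_le {W : Adjoin S → ℝ≥0∞} (hW : Measurable W) {c : ℝ≥0∞}
    (hc : ∀ z a, ∫⁻ y, W (Sum.inl y) ∂(M.jumpExt z a) ≤ (M.jumpExt z a univ + c) * W z)
    (k : ℕ) (h : Hist S k) (s : ℝ) :
    ∫⁻ y, W (Sum.inl y) ∂(π.intensity k (h, s)) ≤ (π.intensity k (h, s) univ + c) * W h.last := by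
  have hj : Measurable fun a => M.jumpExt h.last a univ :=
    (Measure.measurable_coe MeasurableSet.univ).comp
      (M.measurable_jumpExt.comp measurable_prodMk_left)
  have h1 : π.intensity k (h, s) univ = ∫⁻ a, M.jumpExt h.last a univ ∂(π.histProb k h s) := by
    simpa using π.lintegral_intensity k h s (f := fun _ => 1) measurable_const
  rw [π.lintegral_intensity k h s (f := fun y => W (Sum.inl y)) (hW.comp measurable_inl), h1]
  refine (lintegral_mono fun a => hc h.last a).trans ?_
  rw [lintegral_mul_const _ (hj.add_const c), lintegral_add_right _ measurable_const,
    lintegral_const]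
  gcongr
  exact mul_le_of_le_one_right zero_le (π.histProb_univ_le k h s)

/-- The exponential growth bound over one sojourn time. -/
theorem lintegral_stepKernel_weight_le {W : Adjoin S → ℝ≥0∞} (hW : Measurable W) {c : ℝ}
    (hc0 : 0 ≤ c) (hc : ∀ z a, ∫⁻ y, W (Sum.inl y) ∂(M.jumpExt z a)
      ≤ (M.jumpExt z a univ + ENNReal.ofReal c) * W z)
    (k : ℕ) (h : Hist S k) {r : ℝ} (hr : 0 ≤ r) :
    ∫⁻ m, ({m : Mark S | m.1 ≤ ENNReal.ofReal r}.indicator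
        (fun m => ENNReal.ofReal (Real.exp (c * (r - m.1.toReal))) * W m.2) m
      + {m : Mark S | ENNReal.ofReal r < m.1}.indicator (fun _ => W h.last) m)
        ∂(π.stepKernel k h) ≤ ENNReal.ofReal (Real.exp (c * r)) * W h.last := by
  obtain ⟨C, hC⟩ := π.intensity_bounded k h
  have hf : Measurable fun v : ℝ => π.intensity k (h, v) univ :=
    ((π.intensity k).measurable_coe MeasurableSet.univ).comp measurable_prodMk_left
  -- With the hazard raised by c, survival acquires a factor e^{-cu}. After e^{cr} W(x_k) is
  -- factored out, the two contributions, a jump by time r or none, are bounded by the two terms of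
  -- the truncated mass identity for g, which sum to 1.
  set g : ℝ → ℝ≥0∞ := fun v => π.intensity k (h, v) univ + ENNReal.ofReal c with hg
  have hgm : Measurable g := hf.add measurable_const
  have hgC : ∀ v, g v ≤ ((C + c.toNNReal : ℝ≥0) : ℝ≥0∞) := fun v => by
    rw [ENNReal.coe_add]
    exact add_le_add (hC v) le_rfl
  have hcum : ∀ u, 0 ≤ u → expNeg (∫⁻ v in Ioc 0 u, g v)
      = expNeg (π.cumIntensity k h u) * ENNReal.ofReal (Real.exp (-(c * u))) := by
    intro u hu
    rw [lintegral_add_right _ measurable_const, setLIntegral_const, Real.volume_Ioc, sub_zero,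
      ← ENNReal.ofReal_mul hc0, expNeg_add, expNeg_ofReal (mul_nonneg hc0 hu)]
    rfl
  have hexp : ∀ u, ENNReal.ofReal (Real.exp (c * (r - u)))
      = ENNReal.ofReal (Real.exp (c * r)) * ENNReal.ofReal (Real.exp (-(c * u))) := by
    intro u
    rw [← ENNReal.ofReal_mul (Real.exp_nonneg _), ← Real.exp_add]
    congr 2
    ring
  have hs1 : MeasurableSet {m : Mark S | m.1 ≤ ENNReal.ofReal r} :=
    measurableSet_le measurable_fst measurable_const
  have hs2 : MeasurableSet {m : Mark S | ENNReal.ofReal r < m.1} :=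
    measurableSet_lt measurable_const measurable_fst
  have hm1 : Measurable fun m : Mark S =>
      ENNReal.ofReal (Real.exp (c * (r - m.1.toReal))) * W m.2 :=
    ((measurable_fst.ennreal_toReal.const_sub r).const_mul c).exp.ennreal_ofReal.mul
      (hW.comp measurable_snd)
  have hmeas : Measurable fun u => expNeg (∫⁻ v in Ioc 0 u, g v) * g u := by
    have hmono : Monotone fun u => ∫⁻ v in Ioc 0 u, g v := fun u u' huu' =>
      lintegral_mono_set (Ioc_subset_Ioc_right huu')
    exact (measurable_expNeg.comp hmono.measurable).mul hgm
  have h1 : ∫⁻ m, {m : Mark S | m.1 ≤ ENNReal.ofReal r}.indicator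
        (fun m => ENNReal.ofReal (Real.exp (c * (r - m.1.toReal))) * W m.2) m ∂(π.stepKernel k h)
      ≤ ENNReal.ofReal (Real.exp (c * r)) * W h.last *
        ∫⁻ u in Ioc 0 r, expNeg (∫⁻ v in Ioc 0 u, g v) * g u := by
    rw [π.lintegral_stepKernel k h (hm1.indicator hs1), indicator_of_notMem (by simp [cemetery]),
      mul_zero, add_zero, ← lintegral_const_mul _ hmeas, ← Ioi_inter_Iic, inter_comm,
      ← setLIntegral_indicator measurableSet_Iic]
    refine setLIntegral_mono' measurableSet_Ioi fun u hu => ?_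
    · by_cases hur : u ≤ r
      · have h2 : ∀ y : S, {m : Mark S | m.1 ≤ ENNReal.ofReal r}.indicator
            (fun m => ENNReal.ofReal (Real.exp (c * (r - m.1.toReal))) * W m.2)
            (ENNReal.ofReal u, Sum.inl y)
            = ENNReal.ofReal (Real.exp (c * (r - u))) * W (Sum.inl y) := by
          intro y
          have hmem : ((ENNReal.ofReal u, Sum.inl y) : Mark S) ∈
            {m : Mark S | m.1 ≤ ENNReal.ofReal r} := ENNReal.ofReal_le_ofReal hur
          rw [indicator_of_mem hmem, ENNReal.toReal_ofReal (le_of_lt hu)]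
        simp_rw [h2]
        rw [indicator_of_mem (show u ∈ Iic r from hur),
          lintegral_const_mul _ (f := fun y => W (Sum.inl y)) (hW.comp measurable_inl),
          hcum u (le_of_lt hu), hexp]
        calc _ ≤ expNeg (π.cumIntensity k h u) * (ENNReal.ofReal (Real.exp (c * r))
              * ENNReal.ofReal (Real.exp (-(c * u))) * (g u * W h.last)) := by
              gcongr
              exact π.lintegral_intensity_le hW hc k h u
          _ = _ := by ring
      · have h2 : ∀ y : S, {m : Mark S | m.1 ≤ ENNReal.ofReal r}.indicator
            (fun m => ENNReal.ofReal (Real.exp (c * (r - m.1.toReal))) * W m.2)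
            (ENNReal.ofReal u, Sum.inl y) = 0 := fun y =>
          indicator_of_notMem (s := {m : Mark S | m.1 ≤ ENNReal.ofReal r})
            (fun hc => hur ((ENNReal.ofReal_le_ofReal_iff hr).1 hc)) _
        simp [h2]
  rw [lintegral_add_right _ (measurable_const.indicator hs2), lintegral_indicator_const hs2,
    π.stepKernel_tail k h hr]
  calc _ ≤ ENNReal.ofReal (Real.exp (c * r)) * W h.last *
        (∫⁻ u in Ioc 0 r, expNeg (∫⁻ v in Ioc 0 u, g v) * g u)
        + ENNReal.ofReal (Real.exp (c * r)) * W h.last * expNeg (∫⁻ v in Ioc 0 r, g v) := by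
        refine add_le_add h1 (le_of_eq ?_)
        have h3 := hexp r
        rw [sub_self, mul_zero, Real.exp_zero, ENNReal.ofReal_one] at h3
        calc _ = 1 * (expNeg (π.cumIntensity k h r) * W h.last) := by rw [one_mul, mul_comm]
          _ = _ := by
            rw [hcum r hr, h3]
            ring
    _ = _ := by
        rw [← mul_add, lintegral_hazard_Ioc hgm hgC r, mul_one]

/-- The one-sojourn bound with remaining time r = t - T_k, averaged over histories with T_k ≤ t.
After a sojourn θ the exponent c(r - θ) is c(t - T_{k+1}), so the estimate reproduces itself at the
next jump. -/
theorem lintegral_weight_succ_le {W : Adjoin S → ℝ≥0∞} (hW : Measurable W) {c : ℝ}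
    (hc0 : 0 ≤ c) (hc : ∀ z a, ∫⁻ y, W (Sum.inl y) ∂(M.jumpExt z a)
      ≤ (M.jumpExt z a univ + ENNReal.ofReal c) * W z) (x : S) (t : ℝ≥0) (k : ℕ) :
    ∫⁻ ω, {ω | PathSpace.jumpTime (k + 1) ω ≤ t}.indicator (fun ω => ENNReal.ofReal
        (Real.exp (c * (t - (PathSpace.jumpTime (k + 1) ω).toReal))) * W (PathSpace.state (k + 1) ω))
        ω ∂(π.lawFrom x)
      + ∫⁻ ω, {ω | PathSpace.jumpTime k ω ≤ t ∧ t < PathSpace.jumpTime (k + 1) ω}.indicator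
        (fun ω => W (PathSpace.state k ω)) ω ∂(π.lawFrom x)
      ≤ ∫⁻ ω, {ω | PathSpace.jumpTime k ω ≤ t}.indicator (fun ω => ENNReal.ofReal
        (Real.exp (c * (t - (PathSpace.jumpTime k ω).toReal))) * W (PathSpace.state k ω))
        ω ∂(π.lawFrom x) := by
  set r : Hist S k → ℝ := fun h => t - h.time.toReal with hr
  have hrm : Measurable r := (Hist.measurable_time k).ennreal_toReal.const_sub _
  have hs0 : MeasurableSet {z : Hist S k × Mark S | z.1.time ≤ t} :=
    measurableSet_le ((Hist.measurable_time k).comp measurable_fst) measurable_const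
  have hs1 : MeasurableSet {z : Hist S k × Mark S | z.2.1 ≤ ENNReal.ofReal (r z.1)} :=
    measurableSet_le (measurable_fst.comp measurable_snd)
      (hrm.comp measurable_fst).ennreal_ofReal
  have hs2 : MeasurableSet {z : Hist S k × Mark S | ENNReal.ofReal (r z.1) < z.2.1} :=
    measurableSet_lt (hrm.comp measurable_fst).ennreal_ofReal (measurable_fst.comp measurable_snd)
  have hm1 : Measurable fun z : Hist S k × Mark S =>
      ENNReal.ofReal (Real.exp (c * (r z.1 - z.2.1.toReal))) * W z.2.2 :=
    (((hrm.comp measurable_fst).sub (measurable_fst.comp measurable_snd).ennreal_toReal).const_mul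
      c).exp.ennreal_ofReal.mul (hW.comp (measurable_snd.comp measurable_snd))
  have hm2 : Measurable fun z : Hist S k × Mark S => W z.1.last :=
    hW.comp ((Hist.measurable_last k).comp measurable_fst)
  set G : Hist S k × Mark S → ℝ≥0∞ := {z : Hist S k × Mark S | z.1.time ≤ t}.indicator fun z =>
    {z : Hist S k × Mark S | z.2.1 ≤ ENNReal.ofReal (r z.1)}.indicator (fun z =>
      ENNReal.ofReal (Real.exp (c * (r z.1 - z.2.1.toReal))) * W z.2.2) z
    + {z : Hist S k × Mark S | ENNReal.ofReal (r z.1) < z.2.1}.indicator (fun z => W z.1.last) z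
    with hG
  have hGm : Measurable G := ((hm1.indicator hs1).add (hm2.indicator hs2)).indicator hs0
  have hm3 : Measurable fun ω : PathSpace S => {ω | PathSpace.jumpTime k ω ≤ t ∧
      t < PathSpace.jumpTime (k + 1) ω}.indicator (fun ω => W (PathSpace.state k ω)) ω :=
    (hW.comp (PathSpace.measurable_state k)).indicator
      ((measurableSet_le (PathSpace.measurable_jumpTime k) measurable_const).inter
        (measurableSet_lt measurable_const (PathSpace.measurable_jumpTime (k + 1))))
  rw [← lintegral_add_right _ hm3]
  calc _ = ∫⁻ ω, G (PathSpace.hist k ω, ω.1 (k + 1)) ∂(π.lawFrom x) := by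
        refine lintegral_congr fun ω => ?_
        simp only [hG, hr, indicator, mem_ofPred_eq, PathSpace.time_hist]
        by_cases hk : PathSpace.jumpTime k ω ≤ t
        · have hT : PathSpace.jumpTime k ω ≠ ∞ := ne_top_of_le_ne_top ENNReal.coe_ne_top hk
          have h1 : PathSpace.jumpTime (k + 1) ω ≤ t ↔
              (ω.1 (k + 1)).1 ≤ ENNReal.ofReal (t - (PathSpace.jumpTime k ω).toReal) := by
            rw [PathSpace.jumpTime_succ, ENNReal.ofReal_sub _ ENNReal.toReal_nonneg,
              ENNReal.ofReal_toReal hT, ENNReal.ofReal_coe_nnreal]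
            exact (ENNReal.cancel_of_ne hT).le_tsub_iff_left hk |>.symm
          have h2 : (t : ℝ≥0∞) < PathSpace.jumpTime (k + 1) ω ↔
              ENNReal.ofReal (t - (PathSpace.jumpTime k ω).toReal) < (ω.1 (k + 1)).1 := by
            rw [← not_le, h1, not_le]
          simp only [hk, true_and, if_true, h2]
          by_cases h3 : PathSpace.jumpTime (k + 1) ω ≤ t
          · have h4 : (PathSpace.jumpTime (k + 1) ω).toReal
                = (PathSpace.jumpTime k ω).toReal + (ω.1 (k + 1)).1.toReal := by
              rw [PathSpace.jumpTime_succ, ENNReal.toReal_add hT]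
              exact ne_top_of_le_ne_top ENNReal.ofReal_ne_top (h1.1 h3)
            rw [if_pos h3, if_pos (h1.1 h3), h4, sub_sub]
            rfl
          · rw [if_neg h3, if_neg (fun hc => h3 (h1.2 hc))]
            rfl
        · have h1 : ¬ PathSpace.jumpTime (k + 1) ω ≤ t := fun hc =>
            hk ((PathSpace.jumpTime_mono ω (Nat.le_succ k)).trans hc)
          simp [hk, h1]
    _ = _ := π.lintegral_lawFrom_succ x k hGm
    _ ≤ _ := by
        refine lintegral_mono fun ω => ?_
        by_cases hk : PathSpace.jumpTime k ω ≤ t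
        · have h1 : ∀ m : Mark S, G (PathSpace.hist k ω, m) =
              {m : Mark S | m.1 ≤ ENNReal.ofReal (r (PathSpace.hist k ω))}.indicator
                (fun m => ENNReal.ofReal (Real.exp (c * (r (PathSpace.hist k ω) - m.1.toReal)))
                  * W m.2) m
              + {m : Mark S | ENNReal.ofReal (r (PathSpace.hist k ω)) < m.1}.indicator
                (fun _ => W (PathSpace.hist k ω).last) m := by
            intro m
            have : (PathSpace.hist k ω, m) ∈ {z : Hist S k × Mark S | z.1.time ≤ t} := by
              simpa [PathSpace.time_hist] using hk
            rw [hG, indicator_of_mem this]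
            rfl
          have hr0 : 0 ≤ r (PathSpace.hist k ω) := by
            simp only [hr, PathSpace.time_hist, sub_nonneg]
            exact ENNReal.toReal_le_coe_of_le_coe hk
          have hmem : ω ∈ {ω : PathSpace S | PathSpace.jumpTime k ω ≤ t} := hk
          simp_rw [h1]
          rw [indicator_of_mem hmem]
          refine (π.lintegral_stepKernel_weight_le hW hc0 hc k _ hr0).trans_eq ?_
          simp only [hr, PathSpace.time_hist]
          rfl
        · have h1 : ∀ m : Mark S, G (PathSpace.hist k ω, m) = 0 := fun m =>
            indicator_of_notMem (by simpa [PathSpace.time_hist] using hk) _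
          simp [h1]

/-- Both terms are needed: the first bounds the weight at the n-th jump, used for non-explosion; the
sum over windows bounds the weight of ξ_t as n grows. -/
theorem lintegral_weight_add_sum_le {W : Adjoin S → ℝ≥0∞} (hW : Measurable W) {c : ℝ}
    (hc0 : 0 ≤ c) (hc : ∀ z a, ∫⁻ y, W (Sum.inl y) ∂(M.jumpExt z a)
      ≤ (M.jumpExt z a univ + ENNReal.ofReal c) * W z) (x : S) (t : ℝ≥0) (n : ℕ) :
    ∫⁻ ω, {ω | PathSpace.jumpTime n ω ≤ t}.indicator (fun ω => ENNReal.ofReal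
        (Real.exp (c * (t - (PathSpace.jumpTime n ω).toReal))) * W (PathSpace.state n ω))
        ω ∂(π.lawFrom x)
      + ∑ k ∈ Finset.range n, ∫⁻ ω, {ω | PathSpace.jumpTime k ω ≤ t ∧
        t < PathSpace.jumpTime (k + 1) ω}.indicator
        (fun ω => W (PathSpace.state k ω)) ω ∂(π.lawFrom x)
      ≤ ENNReal.ofReal (Real.exp (c * t)) * W (Sum.inl x) := by
  induction n with
  | zero =>
    rw [Finset.range_zero, Finset.sum_empty, add_zero]
    refine (lintegral_mono_ae (g := fun _ => ENNReal.ofReal (Real.exp (c * t)) * W (Sum.inl x))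
      ?_).trans_eq (by simp)
    filter_upwards [π.ae_state_zero x] with ω hω
    refine (indicator_le_self _ _ _).trans_eq ?_
    rw [PathSpace.jumpTime_zero, hω]
    simp
  | succ n ih =>
    rw [Finset.sum_range_succ, add_comm (∑ k ∈ Finset.range n, _), ← add_assoc]
    exact (add_le_add_left (π.lintegral_weight_succ_le hW hc0 hc x t n) _).trans ih

theorem lintegral_weight_state_le {W : Adjoin S → ℝ≥0∞} (hW : Measurable W) {c : ℝ}
    (hc0 : 0 ≤ c) (hc : ∀ z a, ∫⁻ y, W (Sum.inl y) ∂(M.jumpExt z a)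
      ≤ (M.jumpExt z a univ + ENNReal.ofReal c) * W z) (x : S) (t : ℝ≥0) (n : ℕ) :
    ∫⁻ ω, {ω | PathSpace.jumpTime n ω ≤ t}.indicator (fun ω => W (PathSpace.state n ω)) ω
      ∂(π.lawFrom x) ≤ ENNReal.ofReal (Real.exp (c * t)) * W (Sum.inl x) := by
  refine (lintegral_mono fun ω => ?_).trans
    (le_self_add.trans (π.lintegral_weight_add_sum_le hW hc0 hc x t n))
  by_cases hk : PathSpace.jumpTime n ω ≤ t
  · have hmem : ω ∈ {ω : PathSpace S | PathSpace.jumpTime n ω ≤ t} := hk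
    rw [indicator_of_mem hmem, indicator_of_mem hmem]
    refine le_mul_of_one_le_left zero_le ?_
    rw [← ENNReal.ofReal_one]
    refine ENNReal.ofReal_le_ofReal (Real.one_le_exp (mul_nonneg hc0 (sub_nonneg.2 ?_)))
    exact ENNReal.toReal_le_coe_of_le_coe hk
  · have hmem : ω ∉ {ω : PathSpace S | PathSpace.jumpTime n ω ≤ t} := hk
    rw [indicator_of_notMem hmem]
    exact zero_le

/-- The exponential growth bound for the weight of the process. -/
theorem lintegral_weight_process_le {W : Adjoin S → ℝ≥0∞} (hW : Measurable W)
    (hW0 : W (Sum.inr ()) = 0) {c : ℝ}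
    (hc0 : 0 ≤ c) (hc : ∀ z a, ∫⁻ y, W (Sum.inl y) ∂(M.jumpExt z a)
      ≤ (M.jumpExt z a univ + ENNReal.ofReal c) * W z) (x : S) (t : ℝ≥0) :
    ∫⁻ ω, W (PathSpace.process t ω) ∂(π.lawFrom x)
      ≤ ENNReal.ofReal (Real.exp (c * t)) * W (Sum.inl x) := by
  have hm : ∀ k, Measurable fun ω : PathSpace S => {ω | PathSpace.jumpTime k ω ≤ t ∧
      t < PathSpace.jumpTime (k + 1) ω}.indicator (fun ω => W (PathSpace.state k ω)) ω := fun k =>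
    (hW.comp (PathSpace.measurable_state k)).indicator
      ((measurableSet_le (PathSpace.measurable_jumpTime k) measurable_const).inter
        (measurableSet_lt measurable_const (PathSpace.measurable_jumpTime (k + 1))))
  have h1 : ∀ ω : PathSpace S, W (PathSpace.process t ω) = ∑' k, {ω | PathSpace.jumpTime k ω ≤ t ∧
      t < PathSpace.jumpTime (k + 1) ω}.indicator (fun ω => W (PathSpace.state k ω)) ω := by
    intro ω
    by_cases h : ∃ m, PathSpace.jumpTime m ω ≤ t ∧ t < PathSpace.jumpTime (m + 1) ω
    · obtain ⟨m, hm⟩ := h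
      rw [tsum_eq_single m, PathSpace.process_eq_state hm.1 hm.2]
      · have hmem : ω ∈ {ω : PathSpace S | PathSpace.jumpTime m ω ≤ t ∧
          t < PathSpace.jumpTime (m + 1) ω} := hm
        rw [indicator_of_mem hmem]
      · exact fun n hn => indicator_of_notMem (s := {ω : PathSpace S |
          PathSpace.jumpTime n ω ≤ t ∧ t < PathSpace.jumpTime (n + 1) ω})
          (fun hc => hn (PathSpace.eq_of_mem_Ico hc.1 hc.2 hm.1 hm.2)) _
    -- On an exploded path t lies in no window and the series is zero; `hW0` makes the left side
    -- zero as well.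
    · rw [PathSpace.process_eq_inr h, hW0]
      exact (ENNReal.tsum_eq_zero.2 fun k => indicator_of_notMem (s := {ω : PathSpace S |
          PathSpace.jumpTime k ω ≤ t ∧ t < PathSpace.jumpTime (k + 1) ω})
          (fun hc => h ⟨k, hc⟩) _).symm
  simp_rw [h1]
  rw [lintegral_tsum fun k => (hm k).aemeasurable]
  exact ENNReal.tsum_le_of_sum_range_le fun n =>
    le_add_self.trans (π.lintegral_weight_add_sum_le hW hc0 hc x t n)

end Policy

end

/-! ### Non-explosion, and Dynkin's formula in [0, ∞]. -/

section

variable {S A : Type*} [MeasurableSpace S] [MeasurableSpace A]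

namespace Policy

variable [StandardBorelSpace S] {M : Model S A} (π : Policy M)

theorem jumpRate_le_of_le {G : Adjoin S × Adjoin S → ℝ≥0∞} {F : Adjoin S → ℝ≥0∞}
    (h : ∀ z a, ∫⁻ y, G (z, Sum.inl y) ∂(M.jumpExt z a) ≤ F z) (v : ℝ≥0) (ω : PathSpace S) :
    π.jumpRate G v ω ≤ F (PathSpace.process v ω) := by
  have := π.isProbabilityMeasure v ω
  refine (lintegral_mono fun a => h _ a).trans_eq ?_
  simp

/-- The number of jumps up to time `t` from states with bounded jump rates is integrable. -/
theorem ae_tsum_jumps_lt_top (x : S) (t : ℝ≥0) {B : Set S} (hB : MeasurableSet B)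
    (hb : BddAbove (M.maxRate '' B)) :
    ∀ᵐ ω ∂(π.lawFrom x), ∑' k, {ω | PathSpace.jumpTime (k + 1) ω ≤ t}.indicator
      (fun ω => (Sum.inl '' B).indicator (fun _ => (1 : ℝ≥0∞)) (PathSpace.state k ω)) ω < ∞ := by
  obtain ⟨C, hC⟩ := hb
  have hG : Measurable fun p : Adjoin S × Adjoin S =>
      (Sum.inl '' B).indicator (fun _ => (1 : ℝ≥0∞)) p.1 :=
    (measurable_const.indicator hB.inl_image).comp measurable_fst
  have hbound : ∀ z a, ∫⁻ _, (Sum.inl '' B).indicator (fun _ => (1 : ℝ≥0∞)) z ∂(M.jumpExt z a)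
      ≤ ENNReal.ofReal C := by
    intro z a
    rw [lintegral_const]
    by_cases hz : z ∈ Sum.inl '' B
    · obtain ⟨y, hy, rfl⟩ := hz
      rw [indicator_of_mem (mem_image_of_mem _ hy), one_mul]
      exact (M.jumpExt_univ_le _ a).trans (ENNReal.ofReal_le_ofReal (hC ⟨y, hy, rfl⟩))
    · simp [hz]
  have h1 := π.lintegral_tsum_jump x hG t
  refine ae_lt_top (Measurable.tsum fun k => ?_) ?_
  · exact ((measurable_const.indicator hB.inl_image).comp (PathSpace.measurable_state k)).indicator
      (measurableSet_le (PathSpace.measurable_jumpTime (k + 1)) measurable_const)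
  -- The expected number of these jumps is an expected integral over (0, t] of a rate bounded by C.
  · rw [h1]
    refine ne_top_of_le_ne_top ?_ (lintegral_mono fun ω => lintegral_mono fun v =>
      π.jumpRate_le_of_le (F := fun _ => ENNReal.ofReal C) hbound v.toNNReal ω)
    simp [ENNReal.mul_eq_top]

/-- Under the Lyapunov condition the process does not explode. -/
theorem ae_exists_jumpTime {w : S → ℝ} (hw : M.IsLyapunov w) (x : S) (t : ℝ≥0) :
    ∀ᵐ ω ∂(π.lawFrom x), ∃ m, PathSpace.jumpTime m ω ≤ t ∧ t < PathSpace.jumpTime (m + 1) ω := by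
  obtain ⟨ρ, b, Sl, hρ, hb, hSm, hSmono, -, hSinf, hdrift, hrate⟩ := hw.exists_bounds
  have hW : Measurable (Model.ennExt w) := Model.measurable_ennExt hw.measurable
  have hm : ∀ n, Measurable fun ω : PathSpace S => {ω | PathSpace.jumpTime n ω ≤ t}.indicator
      (fun ω => Model.ennExt w (PathSpace.state n ω)) ω := fun n =>
    (hW.comp (PathSpace.measurable_state n)).indicator
      (measurableSet_le (PathSpace.measurable_jumpTime n) measurable_const)
  -- Fatou's lemma, applied to the bound e^{(ρ + b)t} w(x), which is uniform in n.
  have h1 : ∀ᵐ ω ∂(π.lawFrom x), liminf (fun n => {ω | PathSpace.jumpTime n ω ≤ t}.indicator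
      (fun ω => Model.ennExt w (PathSpace.state n ω)) ω) atTop < ∞ := by
    refine ae_lt_top (Measurable.liminf hm) ?_
    refine ne_top_of_le_ne_top (b := ENNReal.ofReal (Real.exp ((ρ + b) * t)) *
      Model.ennExt w (Sum.inl x)) ?_ ((lintegral_liminf_le hm).trans ?_)
    · exact ENNReal.mul_ne_top ENNReal.ofReal_ne_top ENNReal.ofReal_ne_top
    · refine liminf_le_of_le (by isBoundedDefault) fun c hc => ?_
      obtain ⟨n, hn⟩ := hc.exists
      exact hn.trans (π.lintegral_weight_state_le hW (add_nonneg hρ hb)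
        (M.lintegral_jumpExt_le hw.one_le hb hdrift) x t n)
  have h2 := ae_all_iff.2 fun l => π.ae_tsum_jumps_lt_top x t (hSm l) (hrate l)
  filter_upwards [h1, h2] with ω hω1 hω2
  by_contra hne
  have hT : ∀ n, ω ∈ {ω : PathSpace S | PathSpace.jumpTime n ω ≤ t} :=
    PathSpace.jumpTime_le_of_not_exists hne
  have hω1' : liminf (fun n => Model.ennExt w (PathSpace.state n ω)) atTop < ∞ := by
    convert hω1 using 3 with n
    rw [indicator_of_mem (hT n)]
  have hω2' : ∀ l, ∑' k, (Sum.inl '' Sl l).indicator (fun _ => (1 : ℝ≥0∞))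
      (PathSpace.state k ω) < ∞ := by
    intro l
    convert hω2 l using 3 with k
    rw [indicator_of_mem (hT (k + 1))]
  obtain ⟨R, hR, -⟩ := ENNReal.lt_iff_exists_nnreal_btwn.1 hω1'
  have hfreq := frequently_lt_of_liminf_lt (by isBoundedDefault) hR
  -- Outside this S_l the weight exceeds R, so the infinitely many states with weight below R lie in
  -- S_l. The convergent series of visits to S_l has terms tending to 0 and leaves room for only
  -- finitely many.
  obtain ⟨l, hl⟩ := (hSinf.eventually (lt_mem_nhds (EReal.coe_lt_top (R : ℝ)))).exists
  have hlim := ENNReal.tendsto_atTop_zero_of_tsum_ne_top (hω2' l).ne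
  obtain ⟨n, hn1, hn2⟩ := (hfreq.and_eventually
    (hlim.eventually (gt_mem_nhds zero_lt_one))).exists
  obtain ⟨y, hy⟩ := PathSpace.state_mem_range_inl (k := n) (ω := ω)
    (ne_top_of_le_ne_top ENNReal.coe_ne_top (hT n))
  rw [← hy] at hn1 hn2
  have hyR : w y < R := by
    rw [Model.ennExt, Sum.elim_inl, ← ENNReal.ofReal_coe_nnreal] at hn1
    exact lt_of_not_ge fun hc => absurd hn1 (not_lt.2 (ENNReal.ofReal_le_ofReal hc))
  have hyS : y ∈ Sl l := by
    by_contra hc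
    have h3 : ⨅ x ∈ (Sl l)ᶜ, (w x : EReal) ≤ w y := iInf₂_le y hc
    exact absurd (hl.trans_le h3) (not_lt.2 (EReal.coe_le_coe_iff.2 hyR.le))
  rw [indicator_of_mem (mem_image_of_mem _ hyS)] at hn2
  exact lt_irrefl _ hn2

/-- Dynkin's formula for nonnegative functions. -/
theorem lintegral_process_add {w : S → ℝ} (hw : M.IsLyapunov w) (x : S) (t : ℝ≥0)
    {f : Adjoin S → ℝ≥0∞} (hf : Measurable f) :
    ∫⁻ ω, f (PathSpace.process t ω) ∂(π.lawFrom x)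
      + ∫⁻ ω, (∫⁻ v in Ioc (0 : ℝ) t, π.jumpRate (fun p => f p.1) v.toNNReal ω) ∂(π.lawFrom x)
      = f (Sum.inl x)
      + ∫⁻ ω, (∫⁻ v in Ioc (0 : ℝ) t, π.jumpRate (fun p => f p.2) v.toNNReal ω)
        ∂(π.lawFrom x) := by
  have hp : Measurable fun ω : PathSpace S => f (PathSpace.process t ω) :=
    hf.comp (PathSpace.measurable_process.comp measurable_prodMk_left)
  rw [← π.lintegral_tsum_jump x (G := fun p => f p.1) (hf.comp measurable_fst) t,
    ← π.lintegral_tsum_jump x (G := fun p => f p.2) (hf.comp measurable_snd) t,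
    ← lintegral_add_left hp]
  have h0 : f (Sum.inl x) = ∫⁻ _, f (Sum.inl x) ∂(π.lawFrom x) := by simp
  rw [h0, ← lintegral_add_left measurable_const]
  refine lintegral_congr_ae ?_
  filter_upwards [π.ae_exists_jumpTime hw x t, π.ae_state_zero x] with ω h1 h2
  rw [← h2]
  exact PathSpace.telescope h1 f

end Policy

end

/-! ### From [0, ∞] to real-valued functions: integration by parts, and domination by the weights.
-/

section

/-- Integration by parts with an exponential factor. -/
theorem integral_exp_mul_neg_mul_add {m d : ℝ → ℝ} {m₀ α t : ℝ} (ht : 0 ≤ t)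
    (hd : IntervalIntegrable d volume 0 t)
    (hm : ∀ v ∈ Icc 0 t, m v = m₀ + ∫ s in (0 : ℝ)..v, d s) :
    ∫ v in (0 : ℝ)..t, Real.exp (-α * v) * (-α * m v + d v) = m t * Real.exp (-α * t) - m₀ := by
  -- m is known only on [0, t]; its formula, taken on the whole line, is a primitive with derivative
  -- d almost everywhere on the interval.
  set g : ℝ → ℝ := fun v => m₀ + ∫ s in (0 : ℝ)..v, d s with hg
  have hf : AbsolutelyContinuousOnInterval (fun v => Real.exp (-α * v)) 0 t :=
    ContDiffOn.absolutelyContinuousOnInterval (by fun_prop)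
  have hgac : AbsolutelyContinuousOnInterval g 0 t :=
    AbsolutelyContinuousOnInterval.add
      (ContDiffOn.absolutelyContinuousOnInterval (f := fun _ => m₀) (by fun_prop))
      (hd.absolutelyContinuousOnInterval_intervalIntegral (by simp))
  have h := hf.integral_deriv_mul_eq_sub hgac
  have h1 : ∫ v in (0 : ℝ)..t, Real.exp (-α * v) * (-α * m v + d v)
      = ∫ v in (0 : ℝ)..t, deriv (fun v => Real.exp (-α * v)) v * g v
        + Real.exp (-α * v) * deriv g v := by
    refine intervalIntegral.integral_congr_ae ?_
    filter_upwards [hd.ae_hasDerivAt_integral] with v hv hvt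
    have hv' := hv (uIoc_subset_uIcc hvt) 0 (by simp)
    have hdg : deriv g v = d v := (hv'.const_add m₀).deriv
    have hdf : deriv (fun v => Real.exp (-α * v)) v = Real.exp (-α * v) * -α := by
      have := ((hasDerivAt_id v).const_mul (-α)).exp.deriv
      simpa using this
    rw [uIoc_of_le ht] at hvt
    rw [hdg, hdf, hm v (Ioc_subset_Icc_self hvt)]
    ring
  rw [h1, h, hm t ⟨ht, le_rfl⟩]
  simp [hg]
  ring

variable {S A : Type*} [MeasurableSpace S] [MeasurableSpace A]

theorem WeightedBounded.neg {w u : S → ℝ} (h : WeightedBounded w u) :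
    WeightedBounded w fun x => -u x :=
  ⟨h.1.neg, by simpa using h.2⟩

theorem WeightedBounded.abs {w u : S → ℝ} (h : WeightedBounded w u) :
    WeightedBounded w fun x => |u x| :=
  ⟨h.1.abs, by simpa using h.2⟩

theorem WeightedBounded.exists_le {w u : S → ℝ} (hw : ∀ x, 1 ≤ w x) (h : WeightedBounded w u) :
    ∃ C : ℝ≥0, ∀ z, Model.ennExt u z ≤ C * Model.ennExt w z := by
  obtain ⟨C, hC⟩ := h.2
  refine ⟨C.toNNReal, fun z => ?_⟩
  rcases z with x | x
  · have hx : 0 < w x := zero_lt_one.trans_le (hw x)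
    have h1 : |u x| ≤ C * w x := (div_le_iff₀ hx).1 (hC ⟨x, rfl⟩)
    have h2 : 0 ≤ C := (div_nonneg (abs_nonneg (u x)) hx.le).trans (hC ⟨x, rfl⟩)
    change ENNReal.ofReal (u x) ≤ ENNReal.ofReal C * ENNReal.ofReal (w x)
    rw [← ENNReal.ofReal_mul h2]
    exact ENNReal.ofReal_le_ofReal ((le_abs_self _).trans h1)
  · simp [Model.ennExt]

theorem ofReal_extendZero {S : Type*} (u : S → ℝ) (z : Adjoin S) :
    ENNReal.ofReal (extendZero u z) = Model.ennExt u z := by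
  rcases z with x | x <;> simp [extendZero, Model.ennExt]

theorem neg_extendZero {S : Type*} (u : S → ℝ) (z : Adjoin S) :
    -extendZero u z = extendZero (fun x => -u x) z := by
  rcases z with x | x <;> simp [extendZero]

theorem enorm_extendZero {S : Type*} (u : S → ℝ) (z : Adjoin S) :
    ‖extendZero u z‖ₑ = Model.ennExt (fun x => |u x|) z := by
  rw [Real.enorm_eq_ofReal_abs]
  rcases z with x | x <;> simp [extendZero, Model.ennExt]

theorem measurable_extendZero {u : S → ℝ} (hu : Measurable u) : Measurable (extendZero u) :=
  hu.sumElim measurable_const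

theorem measurable_ennExt_fst {u : S → ℝ} (hu : Measurable u) :
    Measurable fun p : Adjoin S × Adjoin S => Model.ennExt u p.1 :=
  (Model.measurable_ennExt hu).comp measurable_fst

theorem measurable_ennExt_snd {u : S → ℝ} (hu : Measurable u) :
    Measurable fun p : Adjoin S × Adjoin S => Model.ennExt u p.2 :=
  (Model.measurable_ennExt hu).comp measurable_snd

variable [StandardBorelSpace S] {M : Model S A}

/-- One constant serves for u at the current state, after a jump, and times the jump rate. With c =
ρ' + b' truncated at 0, the factors 1, rate + c and rate are all at most (1 + c)(q̄ + 1), and (q̄ +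
1) w' ≤ L' w. -/
theorem Model.IsSecondWeight.exists_bound {w w' u : S → ℝ} (hw' : M.IsSecondWeight w w')
    (hu : WeightedBounded w' u) :
    ∃ K : ℝ≥0, (∀ z, Model.ennExt u z ≤ K * Model.ennExt w z) ∧
      (∀ z a, ∫⁻ y, Model.ennExt u (Sum.inl y) ∂(M.jumpExt z a) ≤ K * Model.ennExt w z) ∧
      ∀ z a, ∫⁻ _, Model.ennExt u z ∂(M.jumpExt z a) ≤ K * Model.ennExt w z := by
  obtain ⟨C, hC⟩ := hu.exists_le hw'.one_le
  obtain ⟨L, ρ, b, hL, hρ, hb, hLw, hdrift⟩ := hw'.exists_bounds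
  set c : ℝ≥0 := (ρ + b).toNNReal with hc
  have hLw' : ∀ z, (Model.ennExt M.maxRate z + 1) * Model.ennExt w' z
      ≤ L.toNNReal * Model.ennExt w z := by
    rintro (x | x)
    · change (ENNReal.ofReal (M.maxRate x) + 1) * ENNReal.ofReal (w' x)
        ≤ ENNReal.ofReal L * ENNReal.ofReal (w x)
      rw [← ENNReal.ofReal_one, ← ENNReal.ofReal_add (M.maxRate_nonneg x) zero_le_one,
        ← ENNReal.ofReal_mul (add_nonneg (M.maxRate_nonneg x) zero_le_one), ← ENNReal.ofReal_mul hL]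
      exact ENNReal.ofReal_le_ofReal (hLw x)
    · simp [Model.ennExt]
  have hK : ∀ z, (C : ℝ≥0∞) * ((1 + c) * ((Model.ennExt M.maxRate z + 1) * Model.ennExt w' z))
      ≤ ((C * ((1 + c) * L.toNNReal) : ℝ≥0) : ℝ≥0∞) * Model.ennExt w z := by
    intro z
    push_cast
    rw [mul_assoc, mul_assoc]
    exact mul_le_mul_right (mul_le_mul_right (hLw' z) _) _
  refine ⟨C * ((1 + c) * L.toNNReal), fun z => ?_, fun z a => ?_, fun z a => ?_⟩
  · refine ((hC z).trans ?_).trans (hK z)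
    gcongr
    exact (le_mul_of_one_le_left zero_le le_add_self).trans
      (le_mul_of_one_le_left zero_le le_self_add)
  · refine le_trans ?_ (hK z)
    calc ∫⁻ y, Model.ennExt u (Sum.inl y) ∂(M.jumpExt z a)
        ≤ ∫⁻ y, C * Model.ennExt w' (Sum.inl y) ∂(M.jumpExt z a) := lintegral_mono fun y => hC _
      _ = C * ∫⁻ y, Model.ennExt w' (Sum.inl y) ∂(M.jumpExt z a) :=
          lintegral_const_mul' _ _ ENNReal.coe_ne_top
      _ ≤ C * ((M.jumpExt z a univ + c) * Model.ennExt w' z) := by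
          gcongr
          exact M.lintegral_jumpExt_le hw'.one_le hb hdrift z a
      _ ≤ _ := by
          rw [← mul_assoc (1 + (c : ℝ≥0∞))]
          gcongr
          calc M.jumpExt z a univ + c ≤ Model.ennExt M.maxRate z + c := by
                gcongr
                exact M.jumpExt_univ_le z a
            _ ≤ (Model.ennExt M.maxRate z + 1) + c * (Model.ennExt M.maxRate z + 1) := by
                gcongr
                · exact le_self_add
                · exact le_mul_of_one_le_right zero_le le_add_self
            _ = _ := by ring
  · refine le_trans ?_ (hK z)
    rw [lintegral_const, mul_comm]
    calc M.jumpExt z a univ * Model.ennExt u z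
        ≤ (Model.ennExt M.maxRate z + 1) * (C * Model.ennExt w' z) := by
          gcongr
          · exact (M.jumpExt_univ_le z a).trans le_self_add
          · exact hC z
      _ = C * ((Model.ennExt M.maxRate z + 1) * Model.ennExt w' z) := by ring
      _ ≤ _ := by
          refine mul_le_mul_right ?_ _
          exact le_mul_of_one_le_left zero_le le_self_add

theorem Model.IsSecondWeight.integrable_jump {w w' u : S → ℝ} (hw' : M.IsSecondWeight w w')
    (hu : WeightedBounded w' u) (x : S) (a : A) : Integrable u (M.jump x a) := by
  obtain ⟨K, -, hK, -⟩ := hw'.exists_bound hu.abs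
  refine ⟨hu.1.aestronglyMeasurable, ?_⟩
  simp_rw [HasFiniteIntegral, Real.enorm_eq_ofReal_abs]
  exact (hK (Sum.inl x) (Sum.inl a)).trans_lt
    (ENNReal.mul_lt_top ENNReal.coe_lt_top ENNReal.ofReal_lt_top)

/-- The generator in terms of the positive and negative parts. -/
theorem Model.generator_eq {u : S → ℝ} (hu : ∀ x a, Integrable u (M.jump x a))
    (z : Adjoin S) (a : Adjoin A) :
    M.generator u z a =
      ((∫⁻ y, Model.ennExt u (Sum.inl y) ∂(M.jumpExt z a)).toReal
        - (∫⁻ y, Model.ennExt (fun x => -u x) (Sum.inl y) ∂(M.jumpExt z a)).toReal)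
      - ((∫⁻ _, Model.ennExt u z ∂(M.jumpExt z a)).toReal
        - (∫⁻ _, Model.ennExt (fun x => -u x) z ∂(M.jumpExt z a)).toReal) := by
  rcases z with x | x <;> rcases a with a | a
  · change ∫ᵛ y, u y ∂<•(M.q x a) = _
    rw [M.integral_q (hu x a), integral_eq_lintegral_pos_part_sub_lintegral_neg_part (hu x a)]
    simp only [jumpExt, ennExt, Sum.elim_inl, lintegral_const, ENNReal.toReal_mul, M.jump_univ,
      ENNReal.toReal_ofReal (M.rate_nonneg x a), ← sub_mul]
    rw [ENNReal.toReal_ofReal', ENNReal.toReal_ofReal', max_zero_sub_eq_self, mul_comm]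
  all_goals simp [jumpExt, generator]

/-! ### Integrability, and Dynkin's formula for weighted bounded functions. -/

namespace Policy

variable (π : Policy M)

/-- The growth bound is uniform over times up to t. Every integrability claim on Ω × (0, t] is
reduced to this one by domination. -/
theorem lintegral_prod_weight_ne_top {w : S → ℝ} (hw : M.IsLyapunov w) (x : S) (t : ℝ≥0) :
    ∫⁻ p : PathSpace S × ℝ, Model.ennExt w (PathSpace.process p.2.toNNReal p.1)
      ∂((π.lawFrom x).prod (volume.restrict (Ioc 0 (t : ℝ)))) ≠ ∞ := by
  obtain ⟨ρ, b, Sl, hρ, hb, -, -, -, -, hdrift, -⟩ := hw.exists_bounds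
  have hW : Measurable (Model.ennExt w) := Model.measurable_ennExt hw.measurable
  have hm : Measurable fun p : PathSpace S × ℝ =>
      Model.ennExt w (PathSpace.process p.2.toNNReal p.1) :=
    hW.comp (PathSpace.measurable_process.comp
      (measurable_snd.real_toNNReal.prodMk measurable_fst))
  rw [lintegral_prod_symm' _ hm]
  refine ne_top_of_le_ne_top (b := ∫⁻ v in Ioc 0 (t : ℝ), ENNReal.ofReal (Real.exp ((ρ + b) * t)) *
      Model.ennExt w (Sum.inl x)) ?_ (setLIntegral_mono' measurableSet_Ioc fun v hv => ?_)
  · rw [setLIntegral_const]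
    refine ENNReal.mul_ne_top (ENNReal.mul_ne_top ENNReal.ofReal_ne_top ENNReal.ofReal_ne_top) ?_
    simp
  · refine (π.lintegral_weight_process_le hW rfl (add_nonneg hρ hb)
      (M.lintegral_jumpExt_le hw.one_le hb hdrift) x v.toNNReal).trans ?_
    gcongr
    exact Real.toNNReal_le_iff_le_coe.2 hv.2

variable {w : S → ℝ} {G : Adjoin S × Adjoin S → ℝ≥0∞} {K : ℝ≥0}

theorem jumpRate_lt_top
    (hK : ∀ z a, ∫⁻ y, G (z, Sum.inl y) ∂(M.jumpExt z a) ≤ K * Model.ennExt w z)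
    (v : ℝ≥0) (ω : PathSpace S) : π.jumpRate G v ω < ∞ := by
  refine (π.jumpRate_le_of_le hK v ω).trans_lt (ENNReal.mul_lt_top ENNReal.coe_lt_top ?_)
  rcases PathSpace.process v ω with x | x <;> simp [Model.ennExt]

theorem integrable_toReal_lintegral_jumpExt (hG : Measurable G)
    (hK : ∀ z a, ∫⁻ y, G (z, Sum.inl y) ∂(M.jumpExt z a) ≤ K * Model.ennExt w z)
    (v : ℝ≥0) (ω : PathSpace S) :
    Integrable (fun a => (∫⁻ y, G (PathSpace.process v ω, Sum.inl y)
      ∂(M.jumpExt (PathSpace.process v ω) a)).toReal) (π.prob v ω) :=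
  integrable_toReal_of_lintegral_ne_top
    ((M.measurable_lintegral_jumpExt hG).comp measurable_prodMk_left).aemeasurable
    (π.jumpRate_lt_top hK v ω).ne

theorem integral_toReal_lintegral_jumpExt (hG : Measurable G)
    (hK : ∀ z a, ∫⁻ y, G (z, Sum.inl y) ∂(M.jumpExt z a) ≤ K * Model.ennExt w z)
    (v : ℝ≥0) (ω : PathSpace S) :
    ∫ a, (∫⁻ y, G (PathSpace.process v ω, Sum.inl y)
      ∂(M.jumpExt (PathSpace.process v ω) a)).toReal ∂(π.prob v ω)
      = (π.jumpRate G v ω).toReal := by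
  refine integral_toReal
    ((M.measurable_lintegral_jumpExt hG).comp measurable_prodMk_left).aemeasurable
    (Eventually.of_forall fun a => (hK _ a).trans_lt (ENNReal.mul_lt_top ENNReal.coe_lt_top ?_))
  rcases PathSpace.process v ω with x | x <;> simp [Model.ennExt]

theorem measurable_jumpRate_real (hG : Measurable G) :
    Measurable fun p : PathSpace S × ℝ => π.jumpRate G p.2.toNNReal p.1 :=
  (π.measurable_jumpRate hG).comp (measurable_snd.real_toNNReal.prodMk measurable_fst)

theorem lintegral_jumpRate_ne_top (hw : M.IsLyapunov w)
    (hK : ∀ z a, ∫⁻ y, G (z, Sum.inl y) ∂(M.jumpExt z a) ≤ K * Model.ennExt w z)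
    (x : S) (t : ℝ≥0) :
    ∫⁻ p : PathSpace S × ℝ, π.jumpRate G p.2.toNNReal p.1
      ∂((π.lawFrom x).prod (volume.restrict (Ioc 0 (t : ℝ)))) ≠ ∞ := by
  refine ne_top_of_le_ne_top ?_ (lintegral_mono fun p => π.jumpRate_le_of_le hK _ _)
  rw [lintegral_const_mul' _ _ ENNReal.coe_ne_top]
  exact ENNReal.mul_ne_top ENNReal.coe_ne_top (π.lintegral_prod_weight_ne_top hw x t)

theorem integrable_toReal_jumpRate (hw : M.IsLyapunov w) (hG : Measurable G)
    (hK : ∀ z a, ∫⁻ y, G (z, Sum.inl y) ∂(M.jumpExt z a) ≤ K * Model.ennExt w z)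
    (x : S) (t : ℝ≥0) :
    Integrable (fun p : PathSpace S × ℝ => (π.jumpRate G p.2.toNNReal p.1).toReal)
      ((π.lawFrom x).prod (volume.restrict (Ioc 0 (t : ℝ)))) :=
  integrable_toReal_of_lintegral_ne_top (π.measurable_jumpRate_real hG).aemeasurable
    (π.lintegral_jumpRate_ne_top hw hK x t)

theorem integral_toReal_jumpRate (hG : Measurable G)
    (hK : ∀ z a, ∫⁻ y, G (z, Sum.inl y) ∂(M.jumpExt z a) ≤ K * Model.ennExt w z)
    (x : S) (t : ℝ≥0) :
    ∫ p : PathSpace S × ℝ, (π.jumpRate G p.2.toNNReal p.1).toReal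
      ∂((π.lawFrom x).prod (volume.restrict (Ioc 0 (t : ℝ))))
      = (∫⁻ ω, (∫⁻ v in Ioc (0 : ℝ) t, π.jumpRate G v.toNNReal ω) ∂(π.lawFrom x)).toReal := by
  rw [integral_toReal (π.measurable_jumpRate_real hG).aemeasurable
    (Eventually.of_forall fun p => π.jumpRate_lt_top hK _ _),
    lintegral_prod _ (π.measurable_jumpRate_real hG).aemeasurable]

variable {w' u : S → ℝ}

theorem integrable_generator (hw' : M.IsSecondWeight w w')
    (hu : WeightedBounded w' u) (v : ℝ≥0) (ω : PathSpace S) :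
    Integrable (M.generator u (PathSpace.process v ω)) (π.prob v ω) := by
  obtain ⟨K, -, h2, h1⟩ := hw'.exists_bound hu
  obtain ⟨K', -, h2', h1'⟩ := hw'.exists_bound hu.neg
  simp_rw [funext fun a => Model.generator_eq (hw'.integrable_jump hu) (PathSpace.process v ω) a]
  exact ((π.integrable_toReal_lintegral_jumpExt (measurable_ennExt_snd hu.1) h2 v ω).sub
    (π.integrable_toReal_lintegral_jumpExt (measurable_ennExt_snd hu.neg.1) h2' v ω)).sub
    ((π.integrable_toReal_lintegral_jumpExt (measurable_ennExt_fst hu.1) h1 v ω).sub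
    (π.integrable_toReal_lintegral_jumpExt (measurable_ennExt_fst hu.neg.1) h1' v ω))

/-- The drift is split into four finite jump rates, of the positive and negative parts of u after
and before the jump; the compensator identities apply to each of them. -/
theorem drift_eq (hw' : M.IsSecondWeight w w')
    (hu : WeightedBounded w' u) (v : ℝ≥0) (ω : PathSpace S) :
    π.drift u v ω = ((π.jumpRate (fun p => Model.ennExt u p.2) v ω).toReal
        - (π.jumpRate (fun p => Model.ennExt (fun x => -u x) p.2) v ω).toReal)
      - ((π.jumpRate (fun p => Model.ennExt u p.1) v ω).toReal
        - (π.jumpRate (fun p => Model.ennExt (fun x => -u x) p.1) v ω).toReal) := by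
  obtain ⟨K, -, h2, h1⟩ := hw'.exists_bound hu
  obtain ⟨K', -, h2', h1'⟩ := hw'.exists_bound hu.neg
  have i1 := π.integrable_toReal_lintegral_jumpExt (measurable_ennExt_snd hu.1) h2 v ω
  have i2 := π.integrable_toReal_lintegral_jumpExt (measurable_ennExt_snd hu.neg.1) h2' v ω
  have i3 := π.integrable_toReal_lintegral_jumpExt (measurable_ennExt_fst hu.1) h1 v ω
  have i4 := π.integrable_toReal_lintegral_jumpExt (measurable_ennExt_fst hu.neg.1) h1' v ω
  rw [← π.integral_toReal_lintegral_jumpExt (measurable_ennExt_snd hu.1) h2 v ω,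
    ← π.integral_toReal_lintegral_jumpExt (measurable_ennExt_snd hu.neg.1) h2' v ω,
    ← π.integral_toReal_lintegral_jumpExt (measurable_ennExt_fst hu.1) h1 v ω,
    ← π.integral_toReal_lintegral_jumpExt (measurable_ennExt_fst hu.neg.1) h1' v ω,
    ← integral_sub i1 i2, ← integral_sub i3 i4]
  refine (integral_congr_ae (Eventually.of_forall fun a =>
    Model.generator_eq (hw'.integrable_jump hu) _ a)).trans ?_
  exact integral_sub (i1.sub i2) (i3.sub i4)

theorem integrable_drift (hw : M.IsLyapunov w) (hw' : M.IsSecondWeight w w')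
    (hu : WeightedBounded w' u) (x : S) (t : ℝ≥0) :
    Integrable (fun p : PathSpace S × ℝ => π.drift u p.2.toNNReal p.1)
      ((π.lawFrom x).prod (volume.restrict (Ioc 0 (t : ℝ)))) := by
  obtain ⟨K, -, h2, h1⟩ := hw'.exists_bound hu
  obtain ⟨K', -, h2', h1'⟩ := hw'.exists_bound hu.neg
  simp_rw [π.drift_eq hw' hu]
  exact ((π.integrable_toReal_jumpRate hw (measurable_ennExt_snd hu.1) h2 x t).sub
    (π.integrable_toReal_jumpRate hw (measurable_ennExt_snd hu.neg.1) h2' x t)).sub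
    ((π.integrable_toReal_jumpRate hw (measurable_ennExt_fst hu.1) h1 x t).sub
    (π.integrable_toReal_jumpRate hw (measurable_ennExt_fst hu.neg.1) h1' x t))

theorem lintegral_ennExt_process_ne_top (hw : M.IsLyapunov w) (hw' : M.IsSecondWeight w w')
    (hu : WeightedBounded w' u) (x : S) (t : ℝ≥0) :
    ∫⁻ ω, Model.ennExt u (PathSpace.process t ω) ∂(π.lawFrom x) ≠ ∞ := by
  obtain ⟨K, hK, -, -⟩ := hw'.exists_bound hu
  obtain ⟨ρ, b, Sl, hρ, hb, -, -, -, -, hdrift, -⟩ := hw.exists_bounds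
  refine ne_top_of_le_ne_top ?_ (lintegral_mono fun ω => hK _)
  rw [lintegral_const_mul' _ _ ENNReal.coe_ne_top]
  refine ENNReal.mul_ne_top ENNReal.coe_ne_top (ne_top_of_le_ne_top ?_
    (π.lintegral_weight_process_le (Model.measurable_ennExt hw.measurable) rfl (add_nonneg hρ hb)
      (M.lintegral_jumpExt_le hw.one_le hb hdrift) x t))
  exact ENNReal.mul_ne_top ENNReal.ofReal_ne_top ENNReal.ofReal_ne_top

theorem integrable_process (hw : M.IsLyapunov w) (hw' : M.IsSecondWeight w w')
    (hu : WeightedBounded w' u) (x : S) (t : ℝ≥0) :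
    Integrable (fun ω => extendZero u (PathSpace.process t ω)) (π.lawFrom x) := by
  refine ⟨((measurable_extendZero hu.1).comp (PathSpace.measurable_process.comp
    measurable_prodMk_left)).aestronglyMeasurable, ?_⟩
  simp_rw [HasFiniteIntegral, enorm_extendZero]
  exact (π.lintegral_ennExt_process_ne_top hw hw' hu.abs x t).lt_top

theorem integrable_process_prod (hw : M.IsLyapunov w) (hw' : M.IsSecondWeight w w')
    (hu : WeightedBounded w' u) (x : S) (t : ℝ≥0) :
    Integrable (fun p : PathSpace S × ℝ => extendZero u (PathSpace.process p.2.toNNReal p.1))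
      ((π.lawFrom x).prod (volume.restrict (Ioc 0 (t : ℝ)))) := by
  obtain ⟨K, hK, -, -⟩ := hw'.exists_bound hu.abs
  refine ⟨((measurable_extendZero hu.1).comp (PathSpace.measurable_process.comp
    (measurable_snd.real_toNNReal.prodMk measurable_fst))).aestronglyMeasurable, ?_⟩
  simp_rw [HasFiniteIntegral, enorm_extendZero]
  refine (lintegral_mono fun p => hK _).trans_lt ?_
  rw [lintegral_const_mul' _ _ ENNReal.coe_ne_top]
  exact ENNReal.mul_lt_top ENNReal.coe_lt_top (π.lintegral_prod_weight_ne_top hw x t).lt_top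

/-- Dynkin's formula, the right-hand side being an integral over the product space. -/
theorem integral_process_sub (hw : M.IsLyapunov w) (hw' : M.IsSecondWeight w w')
    (hu : WeightedBounded w' u) (x : S) (t : ℝ≥0) :
    (∫ ω, extendZero u (PathSpace.process t ω) ∂(π.lawFrom x)) - u x
      = ∫ p : PathSpace S × ℝ, π.drift u p.2.toNNReal p.1
        ∂((π.lawFrom x).prod (volume.restrict (Ioc 0 (t : ℝ)))) := by
  obtain ⟨K, -, h2, h1⟩ := hw'.exists_bound hu
  obtain ⟨K', -, h2', h1'⟩ := hw'.exists_bound hu.neg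
  have i1 := π.integrable_toReal_jumpRate hw (measurable_ennExt_snd hu.1) h2 x t
  have i2 := π.integrable_toReal_jumpRate hw (measurable_ennExt_snd hu.neg.1) h2' x t
  have i3 := π.integrable_toReal_jumpRate hw (measurable_ennExt_fst hu.1) h1 x t
  have i4 := π.integrable_toReal_jumpRate hw (measurable_ennExt_fst hu.neg.1) h1' x t
  have hfin : ∀ {G : Adjoin S × Adjoin S → ℝ≥0∞} {K : ℝ≥0}, Measurable G →
      (∀ z a, ∫⁻ y, G (z, Sum.inl y) ∂(M.jumpExt z a) ≤ K * Model.ennExt w z) →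
      ∫⁻ ω, (∫⁻ v in Ioc (0 : ℝ) t, π.jumpRate G v.toNNReal ω) ∂(π.lawFrom x) ≠ ∞ := by
    intro G K hG hK
    have := π.lintegral_jumpRate_ne_top hw hK x t
    rwa [lintegral_prod _ (π.measurable_jumpRate_real hG).aemeasurable] at this
  -- `ennExt` truncates at 0, so `ennExt u` and `ennExt (-u)` are the positive and negative parts of
  -- u. The two identities consist of finite terms and their difference is the formula.
  have e1 := congrArg ENNReal.toReal
    (π.lintegral_process_add hw x t (Model.measurable_ennExt hu.1))
  have e2 := congrArg ENNReal.toReal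
    (π.lintegral_process_add hw x t (Model.measurable_ennExt hu.neg.1))
  rw [ENNReal.toReal_add (π.lintegral_ennExt_process_ne_top hw hw' hu x t)
    (hfin (measurable_ennExt_fst hu.1) h1), ENNReal.toReal_add
    (by simp [Model.ennExt] : Model.ennExt _ (Sum.inl x) ≠ ∞)
    (hfin (measurable_ennExt_snd hu.1) h2)] at e1
  rw [ENNReal.toReal_add (π.lintegral_ennExt_process_ne_top hw hw' hu.neg x t)
    (hfin (measurable_ennExt_fst hu.neg.1) h1'), ENNReal.toReal_add
    (by simp [Model.ennExt] : Model.ennExt _ (Sum.inl x) ≠ ∞)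
    (hfin (measurable_ennExt_snd hu.neg.1) h2')] at e2
  simp_rw [π.drift_eq hw' hu]
  refine Eq.trans ?_ (integral_sub (i1.sub i2) (i3.sub i4)).symm
  rw [integral_sub' i1 i2, integral_sub' i3 i4,
    π.integral_toReal_jumpRate (measurable_ennExt_snd hu.1) h2,
    π.integral_toReal_jumpRate (measurable_ennExt_snd hu.neg.1) h2',
    π.integral_toReal_jumpRate (measurable_ennExt_fst hu.1) h1,
    π.integral_toReal_jumpRate (measurable_ennExt_fst hu.neg.1) h1',
    integral_eq_lintegral_pos_part_sub_lintegral_neg_part (π.integrable_process hw hw' hu x t)]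
  simp_rw [neg_extendZero, ofReal_extendZero]
  have e3 : u x = (Model.ennExt u (Sum.inl x)).toReal
      - (Model.ennExt (fun x => -u x) (Sum.inl x)).toReal := by
    simp only [Model.ennExt, Sum.elim_inl, ENNReal.toReal_ofReal']
    exact (max_zero_sub_eq_self _).symm
  linarith

end Policy

end

end CTMDP

end

theorem theorem2 {S A : Type*} [MeasurableSpace S] [StandardBorelSpace S]
    [MeasurableSpace A] [StandardBorelSpace A] (M : Model S A) (w w' : S → ℝ)
    (hw : M.IsLyapunov w) (hw' : M.IsSecondWeight w w') (α : ℝ) (hα : 0 < α)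
    (π : Policy M) (u : S → ℝ) (hu : WeightedBounded w' u) (x : S) (t : ℝ≥0) :
    -- all the expressions in the two formulas are well defined
    (∀ y, ∀ a ∈ M.adm y, (M.q y a).Integrable u) ∧
    (∀ v ω, Integrable (M.generator u (PathSpace.process v ω)) (π.prob v ω)) ∧
    π.lawFrom x {ω | PathSpace.process t ω ∈ Set.range Sum.inl} = 1 ∧
    Integrable (fun ω => extendZero u (PathSpace.process t ω)) (π.lawFrom x) ∧
    Integrable (fun p : PathSpace S × ℝ => π.drift u p.2.toNNReal p.1)
      ((π.lawFrom x).prod (volume.restrict (Set.Ioc 0 (t : ℝ)))) ∧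
    Integrable (fun p : PathSpace S × ℝ => Real.exp (-α * p.2) *
        (-α * extendZero u (PathSpace.process p.2.toNNReal p.1) + π.drift u p.2.toNNReal p.1))
      ((π.lawFrom x).prod (volume.restrict (Set.Ioc 0 (t : ℝ)))) ∧
    -- Dynkin's formula
    (∫ ω, extendZero u (PathSpace.process t ω) ∂(π.lawFrom x)) - u x =
      ∫ ω, (∫ v in (0 : ℝ)..t, π.drift u v.toNNReal ω) ∂(π.lawFrom x) ∧
    -- Dynkin's formula, discounted version
    (∫ ω, extendZero u (PathSpace.process t ω) ∂(π.lawFrom x)) * Real.exp (-α * t) - u x =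
      ∫ ω, (∫ v in (0 : ℝ)..t, Real.exp (-α * v) *
        (-α * extendZero u (PathSpace.process v.toNNReal ω) + π.drift u v.toNNReal ω))
        ∂(π.lawFrom x) := by

  have ht : 0 ≤ (t : ℝ) := t.coe_nonneg
  have hprod := π.integrable_drift hw hw' hu x t
  have hproc := π.integrable_process_prod hw hw' hu x t
  have hexp : Integrable (fun p : PathSpace S × ℝ => Real.exp (-α * p.2) *
      (-α * extendZero u (PathSpace.process p.2.toNNReal p.1) + π.drift u p.2.toNNReal p.1))
      ((π.lawFrom x).prod (volume.restrict (Set.Ioc 0 (t : ℝ)))) := by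
    have hbd : ∀ᵐ p ∂((π.lawFrom x).prod (volume.restrict (Set.Ioc 0 (t : ℝ)))),
        ‖Real.exp (-α * p.2)‖ ≤ 1 := by
      have h1 : ∀ᵐ v ∂(volume.restrict (Set.Ioc 0 (t : ℝ))), ‖Real.exp (-α * v)‖ ≤ 1 := by
        filter_upwards [ae_restrict_mem measurableSet_Ioc] with v hv
        rw [Real.norm_of_nonneg (Real.exp_nonneg _), Real.exp_le_one_iff]
        nlinarith [hv.1]
      exact Measure.quasiMeasurePreserving_snd.ae h1
    exact ((hproc.const_mul (-α)).add hprod).bdd_mul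
      (by fun_prop : Measurable fun p : PathSpace S × ℝ => Real.exp (-α * p.2)).aestronglyMeasurable
      hbd
  -- The time is left free: the discounted formula uses the undiscounted one at every v in [0, t].
  have hdyn := π.integral_process_sub hw hw' hu x
  have hd : IntervalIntegrable (fun v => ∫ ω, π.drift u v.toNNReal ω ∂(π.lawFrom x)) volume 0 t :=
    (intervalIntegrable_iff_integrableOn_Ioc_of_le ht).2 hprod.integral_prod_right
  refine ⟨fun y a _ => (M.integrable_q_iff y a u).2 (hw'.integrable_jump hu y a),
    π.integrable_generator hw' hu, ?_, π.integrable_process hw hw' hu x t, hprod, hexp, ?_, ?_⟩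
  · have hms : MeasurableSet {ω : PathSpace S | PathSpace.process t ω ∈ Set.range Sum.inl} :=
      (PathSpace.measurable_process.comp measurable_prodMk_left) measurableSet_range_inl
    rw [← mem_ae_iff_prob_eq_one hms]
    filter_upwards [π.ae_exists_jumpTime hw x t] with ω hω
    obtain ⟨m, h1, h2⟩ := hω
    rw [PathSpace.process_eq_state h1 h2]
    exact PathSpace.state_mem_range_inl (ne_top_of_le_ne_top ENNReal.coe_ne_top h1)
  · rw [hdyn t, integral_prod _ hprod]
    simp_rw [intervalIntegral.integral_of_le ht]
  -- By Fubini the mean of u(ξ_v) is u(x) plus the primitive of the mean drift, as integration by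
  -- parts requires.
  · have hm : ∀ v ∈ Set.Icc 0 (t : ℝ),
        ∫ ω, extendZero u (PathSpace.process v.toNNReal ω) ∂(π.lawFrom x)
          = u x + ∫ s in (0 : ℝ)..v, ∫ ω, π.drift u s.toNNReal ω ∂(π.lawFrom x) := by
      intro v hv
      have h1 := hdyn v.toNNReal
      rw [Real.coe_toNNReal v hv.1, integral_prod_symm _ (by
        simpa [Real.coe_toNNReal v hv.1] using π.integrable_drift hw hw' hu x v.toNNReal)] at h1
      rw [intervalIntegral.integral_of_le hv.1]
      linarith
    have h2 := integral_exp_mul_neg_mul_add (α := α) ht hd hm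
    rw [Real.toNNReal_coe] at h2
    rw [← h2]
    simp_rw [intervalIntegral.integral_of_le ht]
    rw [← integral_prod _ hexp, integral_prod_symm _ hexp]
    refine integral_congr_ae ?_
    -- Splitting the inner expectation needs the drift to be integrable in ω, which Fubini provides
    -- for almost every v.
    filter_upwards [hprod.prod_left_ae] with v hv
    rw [integral_const_mul, integral_add
      ((π.integrable_process hw hw' hu x v.toNNReal).const_mul (-α)) hv, integral_const_mul]
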